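/- Let $p$ be a prime, $k$ an algebraically closed field of characteristic $p$, $G=\mathrm{SL}_2(\mathbb F_p)$, and let $n$ be an integer with $2\le n\le p-2$. For $i\ge 1$ let $V_i$ be the $i$-dimensional $kG$-module of homogeneous polynomials over $k$ of degree $i-1$ in $X,Y$, on which $\begin{pmatrix}a&b\\c&d\end{pmatrix}$ acts by $f(X,Y)\mapsto f(aX+cY,\,bX+dY)$. For a finite-dimensional $kG$-module $U$ and an indecomposable $kG$-module $M$, write $[U:M]$ for the multiplicity of $M$ as an indecomposable direct summand of $U$. Let $w$ assign a positive weight to each isomorphism class of (finite-dimensional) non-projective indecomposable $kG$-modules. The non-projective summand random walk steps from a non-projective indecomposable module $U$ to a non-projective indecomposable module $M$ with probability $$Q_{U,M}=\frac{w(M)\,[U\otimes V_n:M]}{\sum_{N} w(N)\,[U\otimes V_n:N]},$$ where $N$ runs over the isomorphism classes of non-projective indecomposable $kG$-modules. For $i,j\in\{1,\dots,p-1\}$ put $Q_{i,j}=Q_{V_i,V_j}$ and $A_{i,j}=[V_i\otimes V_n:V_j]$, and let $d(i)=\sum_{j=1}^{p-1}A_{i,j}$ be the degree of $i$ in the graph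 (with loops, each contributing $1$) on $\{1,\dots,p-1\}$ with adjacency matrix $A$. Take uniform weights $w\equiv 1$. Then the modules $V_1,\dots,V_{p-1}$ are non-projective and indecomposable, the matrix $Q=(Q_{i,j})_{1\le i,j\le p-1}$ is a transition matrix (its entries are nonnegative and its rows sum to $1$), and $$Q_{i,j}=\frac{A_{i,j}}{d(i)}\qquad(1\le i,j\le p-1).$$ Moreover $$\pi_i=\frac{\min\{i,\,p-i,\,n,\,p-n\}}{n(p-n)}\qquad(1\le i\le p-1)$$ defines a stationary distribution of $Q$, that is, $\pi_i\ge 0$, $\sum_i\pi_i=1$ and $\pi Q=\pi$, and it gives equal mass to the odd and the even states: $$\sum_{i\text{ odd}}\pi_i=\sum_{i\text{ even}}\pi_i=\frac12 .$$ -/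

import Mathlib

universe u

namespace SummandWalk

open CategoryTheory

section General

variable {k G : Type*} [Field k] [Monoid G]

/-- A representation is indecomposable if it is nonzero and is not the direct sum of two nonzero
subrepresentations. -/
def IsIndecomposable {V : Type*} [AddCommMonoid V] [Module k V] (ρ : Representation k G V) : Prop :=
  Nontrivial V ∧ ∀ W₁ W₂ : Subrepresentation ρ, IsCompl W₁ W₂ → W₁ = ⊥ ∨ W₂ = ⊥

/-- A representation is projective if it is projective as a module over the group algebra. -/
def IsProjective {V : Type*} [AddCommMonoid V] [Module k V] (ρ : Representation k G V) : Prop :=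
  Module.Projective (MonoidAlgebra k G) ρ.asModule

/-- `σ` is isomorphic to a direct summand of `ρ`, i.e. `σ` is a retract of `ρ`. -/
def IsSummand {W V : Type*} [AddCommMonoid W] [Module k W] [AddCommMonoid V] [Module k V]
    (σ : Representation k G W) (ρ : Representation k G V) : Prop :=
  ∃ (i : σ.IntertwiningMap ρ) (r : ρ.IntertwiningMap σ),
    r.comp i = Representation.IntertwiningMap.id σ

/-- The multiplicity `[ρ : σ]` of an indecomposable `σ` as an indecomposable summand of a
finite-dimensional representation `ρ`: the largest `m` such that the direct sum of `m` copies
of `σ` is isomorphic to a direct summand of `ρ`. By Krull-Schmidt this is the number of summands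
isomorphic to `σ` in any decomposition of `ρ` into indecomposables. -/
noncomputable def multiplicity {V W : Type*} [AddCommMonoid V] [Module k V]
    [AddCommMonoid W] [Module k W]
    (ρ : Representation k G V) (σ : Representation k G W) : ℕ :=
  sSup {m : ℕ | IsSummand (Representation.directSum fun _ : Fin m => σ) ρ}

end General

section Walk

variable (k : Type u) (G : Type) [Field k] [Monoid G]

/-- The finite-dimensional non-projective indecomposable `kG`-modules. -/
abbrev NonProjIndec : Type (u + 1) :=
  {M : FDRep k G // IsIndecomposable M.ρ ∧ ¬ IsProjective M.ρ}

/-- Isomorphism of non-projective indecomposable `kG`-modules. -/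
instance isoSetoid : Setoid (NonProjIndec k G) where
  r M N := Nonempty (Representation.Equiv M.1.ρ N.1.ρ)
  iseqv :=
    { refl := fun _ => ⟨Representation.Equiv.refl _⟩
      symm := fun ⟨e⟩ => ⟨e.symm⟩
      trans := fun ⟨e⟩ ⟨f⟩ => ⟨e.trans f⟩ }

/-- The set of isomorphism classes of non-projective indecomposable `kG`-modules. -/
abbrev IsoClass : Type (u + 1) := Quotient (isoSetoid k G)

variable {k G}

/-- The transition probability `Q_{UV}` from `U` to `V` of the non-projective summand random walk
given by tensoring with `τ`, for the weight function `w`: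
`w(V) [U ⊗ τ : V] / ∑_M w(M) [U ⊗ τ : M]`, where `M` runs over the isomorphism classes of
non-projective indecomposable modules (only finitely many terms are nonzero). -/
noncomputable def transitionProb {T : Type*} [AddCommMonoid T] [Module k T]
    (τ : Representation k G T) (w : IsoClass k G → ℝ) (U V : NonProjIndec k G) : ℝ :=
  w (Quotient.mk _ V) * (multiplicity (Representation.tprod U.1.ρ τ) V.1.ρ : ℝ) /
    ∑ᶠ M : IsoClass k G, w M * (multiplicity (Representation.tprod U.1.ρ τ) M.out.1.ρ : ℝ)

end Walk

section SL2

/-- The group `SL₂(𝔽_p)`. -/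
abbrev SL2 (p : ℕ) : Type := Matrix.SpecialLinearGroup (Fin 2) (ZMod p)

variable (k : Type u) [Field k] (p : ℕ) [CharP k p]

/-- The substitution `f(X, Y) ↦ f(aX + cY, bX + dY)` attached to a matrix `(a, b; c, d)` over
`𝔽_p`, with `X` and `Y` the variables with index `0` and `1`. -/
noncomputable def substHom (g : SL2 p) : MvPolynomial (Fin 2) k →ₐ[k] MvPolynomial (Fin 2) k :=
  MvPolynomial.aeval fun j => ∑ i : Fin 2,
    MvPolynomial.C (ZMod.castHom (dvd_refl p) k ((g : Matrix (Fin 2) (Fin 2) (ZMod p)) i j)) *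
      MvPolynomial.X i

lemma substHom_X (g : SL2 p) (j : Fin 2) :
    substHom k p g (MvPolynomial.X j) = ∑ i : Fin 2,
      MvPolynomial.C (ZMod.castHom (dvd_refl p) k ((g : Matrix (Fin 2) (Fin 2) (ZMod p)) i j)) *
        MvPolynomial.X i := by
  simp only [substHom, MvPolynomial.aeval_X]

lemma substHom_one : substHom k p 1 = AlgHom.id k _ := by
  refine MvPolynomial.algHom_ext fun j => ?_
  rw [substHom_X]
  fin_cases j <;> simp

lemma substHom_mul (g h : SL2 p) :
    substHom k p (g * h) = (substHom k p g).comp (substHom k p h) := by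
  refine MvPolynomial.algHom_ext fun j => ?_
  rw [AlgHom.comp_apply, substHom_X, substHom_X]
  simp only [map_mul, Fin.sum_univ_two, substHom_X, ← MvPolynomial.algebraMap_eq,
    AlgHom.commutes, Matrix.SpecialLinearGroup.coe_mul, Matrix.mul_apply, map_add]
  ring

lemma substHom_mem (g : SL2 p) (d : ℕ) {f : MvPolynomial (Fin 2) k}
    (hf : f ∈ MvPolynomial.homogeneousSubmodule (Fin 2) k d) :
    substHom k p g f ∈ MvPolynomial.homogeneousSubmodule (Fin 2) k d := by
  rw [MvPolynomial.mem_homogeneousSubmodule] at hf ⊢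
  have h := hf.aeval (n := 1) (fun j => ∑ i : Fin 2,
    MvPolynomial.C (ZMod.castHom (dvd_refl p) k ((g : Matrix (Fin 2) (Fin 2) (ZMod p)) i j)) *
      MvPolynomial.X i) fun j => MvPolynomial.IsHomogeneous.sum _ _ _ fun i _ =>
        MvPolynomial.isHomogeneous_C_mul_X _ _
  rwa [one_mul] at h

/-- For `n ≥ 1`, the `kG`-module `V_n` of dimension `n`, for `G = SL₂(𝔽_p)`: the homogeneous
polynomials of degree `n - 1` in two variables, with `g` acting by the substitution attached
to `g`. -/
noncomputable def homogRep (n : ℕ) :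
    Representation k (SL2 p) (MvPolynomial.homogeneousSubmodule (Fin 2) k (n - 1)) where
  toFun g := (substHom k p g).toLinearMap.restrict fun _ hf => substHom_mem k p g (n - 1) hf
  map_one' := by
    ext f
    simp [substHom_one]
  map_mul' g h := by
    refine LinearMap.ext fun f => Subtype.ext ?_
    simp only [substHom_mul]
    rfl

instance (d : ℕ) : Module.Finite k (MvPolynomial.homogeneousSubmodule (Fin 2) k d) :=
  Module.Finite.iff_fg.mpr (MvPolynomial.homogeneousSubmodule_fg (Fin 2) k d)

/-- `V_n` as an object of the category of finite-dimensional `kG`-modules. -/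
noncomputable abbrev V (n : ℕ) : FDRep k (SL2 p) := FDRep.of (homogRep k p n)

/-- The label set `[p - 1] = {1, …, p - 1}`. -/
abbrev State (p : ℕ) : Type := Finset.Icc 1 (p - 1)

/-- The matrix `A` with entries `A_{i,j} = [V_i ⊗ V_n : V_j]`, which is the adjacency matrix of a
graph on `[p - 1]` with loops. -/
noncomputable def A (n : ℕ) : Matrix (State p) (State p) ℕ := fun i j =>
  multiplicity ((homogRep k p i).tprod (homogRep k p n)) (homogRep k p j)

/-- The degree `d(i)` of the vertex `i` in the graph with adjacency matrix `A`, a loop contributing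
`1` to the degree. -/
noncomputable def degree (n : ℕ) (i : State p) : ℕ := ∑ j : State p, A k p n i j

/-- The transition matrix of the non-projective summand random walk (tensoring by `V_n`, with weight
function `w`) on the states `V_1, …, V_{p-1}`, labelled by their dimensions. -/
noncomputable def Q (n : ℕ) (w : IsoClass k (SL2 p) → ℝ)
    (hV : ∀ i : State p, IsIndecomposable (V k p i).ρ ∧ ¬ IsProjective (V k p i).ρ) :
    Matrix (State p) (State p) ℝ := fun i j =>
  transitionProb (homogRep k p n) w ⟨V k p i, hV i⟩ ⟨V k p j, hV j⟩

end SL2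

/-- `π` is a stationary distribution of the finite Markov chain with transition matrix `P`: it is a
probability vector with `π P = π`. -/
def IsStationaryDistribution {S : Type*} [Fintype S] (P : Matrix S S ℝ) (π : S → ℝ) : Prop :=
  ((∀ i, 0 ≤ π i) ∧ ∑ i, π i = 1) ∧ Matrix.vecMul π P = π

end SummandWalk

namespace SummandWalk

open Representation TensorProduct

/-! ### Direct sums and summands of representations under tensor products -/

section Functoriality

variable {k G : Type*} [Field k] [Monoid G]
variable {X Y Z T : Type*} [AddCommMonoid X] [Module k X] [AddCommMonoid Y] [Module k Y]
  [AddCommMonoid Z] [Module k Z] [AddCommMonoid T] [Module k T]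
variable {ρ : Representation k G X} {σ : Representation k G Y} {τ : Representation k G Z}
  {υ : Representation k G T}

lemma lTensor_comp (ρ : Representation k G X) (f : τ.IntertwiningMap υ)
    (g : σ.IntertwiningMap τ) : (f.comp g).lTensor ρ = (f.lTensor ρ).comp (g.lTensor ρ) := by
  ext x y
  simp [IntertwiningMap.toLinearMap_apply]

lemma rTensor_comp (ρ : Representation k G X) (f : τ.IntertwiningMap υ)
    (g : σ.IntertwiningMap τ) : (f.comp g).rTensor ρ = (f.rTensor ρ).comp (g.rTensor ρ) := by
  ext x y
  simp [IntertwiningMap.toLinearMap_apply]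

lemma single_smul_asModule (g : G) (v : ρ.asModule) :
    MonoidAlgebra.single g (1 : k) • v = (ρ g (ρ.asModuleEquiv v) : X) := by
  rw [single_smul, one_smul]

/-- `τ` is the direct sum of `σ` and `υ`. -/
def IsBiproduct (τ : Representation k G Z) (σ : Representation k G Y)
    (υ : Representation k G T) : Prop :=
  ∃ (i : σ.IntertwiningMap τ) (q : τ.IntertwiningMap σ) (i' : υ.IntertwiningMap τ)
    (q' : τ.IntertwiningMap υ), q.comp i = .id σ ∧ q'.comp i' = .id υ ∧ q.comp i' = 0 ∧
      q'.comp i = 0 ∧ i.comp q + i'.comp q' = .id τ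

lemma IsBiproduct.lTensor (h : IsBiproduct τ σ υ) (ρ : Representation k G X) :
    IsBiproduct (ρ.tprod τ) (ρ.tprod σ) (ρ.tprod υ) := by
  obtain ⟨i, q, i', q', h₁, h₂, h₃, h₄, h₅⟩ := h
  refine ⟨i.lTensor ρ, q.lTensor ρ, i'.lTensor ρ, q'.lTensor ρ, ?_, ?_, ?_, ?_, ?_⟩
  · rw [← lTensor_comp, h₁, IntertwiningMap.lTensor_id]
  · rw [← lTensor_comp, h₂, IntertwiningMap.lTensor_id]
  · rw [← lTensor_comp, h₃, IntertwiningMap.lTensor_zero]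
  · rw [← lTensor_comp, h₄, IntertwiningMap.lTensor_zero]
  · rw [← lTensor_comp, ← lTensor_comp, ← IntertwiningMap.lTensor_add, h₅,
      IntertwiningMap.lTensor_id]

lemma IsBiproduct.rTensor (h : IsBiproduct τ σ υ) (ρ : Representation k G X) :
    IsBiproduct (τ.tprod ρ) (σ.tprod ρ) (υ.tprod ρ) := by
  obtain ⟨i, q, i', q', h₁, h₂, h₃, h₄, h₅⟩ := h
  refine ⟨i.rTensor ρ, q.rTensor ρ, i'.rTensor ρ, q'.rTensor ρ, ?_, ?_, ?_, ?_, ?_⟩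
  · rw [← rTensor_comp, h₁, IntertwiningMap.rTensor_id]
  · rw [← rTensor_comp, h₂, IntertwiningMap.rTensor_id]
  · rw [← rTensor_comp, h₃, IntertwiningMap.rTensor_zero]
  · rw [← rTensor_comp, h₄, IntertwiningMap.rTensor_zero]
  · rw [← rTensor_comp, ← rTensor_comp, ← IntertwiningMap.rTensor_add, h₅,
      IntertwiningMap.rTensor_id]

lemma IsBiproduct.isSummand_left (h : IsBiproduct τ σ υ) : IsSummand σ τ := by
  obtain ⟨i, q, -, -, h, -⟩ := h
  exact ⟨i, q, h⟩

lemma isSummand_of_equiv (e : σ.Equiv τ) : IsSummand σ τ :=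
  ⟨e.toIntertwiningMap, e.symm.toIntertwiningMap, congrArg Equiv.toIntertwiningMap e.trans_symm⟩

lemma IsSummand.trans {σ : Representation k G Y} {τ : Representation k G Z}
    {υ : Representation k G T} (h : IsSummand σ τ) (h' : IsSummand τ υ) : IsSummand σ υ := by
  obtain ⟨i, r, h⟩ := h
  obtain ⟨i', r', h'⟩ := h'
  refine ⟨i'.comp i, r.comp r', ?_⟩
  have : (r.comp r').comp (i'.comp i) = r.comp ((r'.comp i').comp i) := rfl
  rw [this, h']
  exact h

lemma IsSummand.lTensor (h : IsSummand σ τ) (ρ : Representation k G X) :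
    IsSummand (ρ.tprod σ) (ρ.tprod τ) := by
  obtain ⟨i, r, h⟩ := h
  refine ⟨i.lTensor ρ, r.lTensor ρ, ?_⟩
  rw [← lTensor_comp, h, IntertwiningMap.lTensor_id]

variable (σ) in
/-- The inclusion of a summand into a direct sum of copies. -/
noncomputable def directSumIncl (m : ℕ) (a : Fin m) :
    σ.IntertwiningMap (Representation.directSum fun _ : Fin m => σ) :=
  LinearMap.intertwiningMap_of_isIntertwiningMap _ _ (DirectSum.lof k (Fin m) (fun _ => Y) a)
    fun g v => by simp

variable (σ) in
/-- The projection of a direct sum of copies onto a summand. -/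
noncomputable def directSumProj (m : ℕ) (a : Fin m) :
    (Representation.directSum fun _ : Fin m => σ).IntertwiningMap σ :=
  LinearMap.intertwiningMap_of_isIntertwiningMap _ _
    (DirectSum.component k (Fin m) (fun _ => Y) a) fun _ _ => rfl

lemma directSumProj_comp_incl (m : ℕ) (a b : Fin m) :
    (directSumProj σ m b).comp (directSumIncl σ m a) = if a = b then .id σ else 0 := by
  ext v
  change DirectSum.component k _ _ _ (DirectSum.lof k _ _ _ _) = _
  split_ifs with h
  · subst h
    rw [DirectSum.component.lof_self]
    rfl
  · rw [DirectSum.component.of, dif_neg h]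
    rfl

lemma isSummand_directSum (h : IsSummand σ τ) (m : ℕ) :
    IsSummand (Representation.directSum fun _ : Fin m => σ)
      (Representation.directSum fun _ : Fin m => τ) := by
  obtain ⟨i, r, h⟩ := h
  refine ⟨LinearMap.intertwiningMap_of_isIntertwiningMap _ _
      (DirectSum.lmap fun _ => i.toLinearMap) fun g v => ?_,
    LinearMap.intertwiningMap_of_isIntertwiningMap _ _
      (DirectSum.lmap fun _ => r.toLinearMap) fun g v => ?_, ?_⟩
  · ext a
    simp [IntertwiningMap.toLinearMap_apply, i.isIntertwining]
  · ext a
    simp [IntertwiningMap.toLinearMap_apply, r.isIntertwining]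
  · refine IntertwiningMap.ext (LinearMap.ext fun v => ?_)
    refine DFinsupp.ext fun a => ?_
    exact DFunLike.congr_fun h (v a)

end Functoriality

/-! ### Relative traces, Higman's criterion and stable Hom -/

section Transfer

variable {k G : Type*} [Field k] [Group G] [Fintype G]
variable {X Y Z T : Type*} [AddCommGroup X] [Module k X] [AddCommGroup Y] [Module k Y]
  [AddCommGroup Z] [Module k Z] [AddCommGroup T] [Module k T]
variable (ρ : Representation k G X) (σ : Representation k G Y) (τ : Representation k G Z)
  (υ : Representation k G T)

/-- The relative trace `φ ↦ ∑ g, g φ g⁻¹` from linear maps to intertwining maps. -/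
def transfer : (X →ₗ[k] Y) →ₗ[k] ρ.IntertwiningMap σ where
  toFun φ := LinearMap.intertwiningMap_of_isIntertwiningMap ρ σ
    (∑ g : G, σ g ∘ₗ φ ∘ₗ ρ g⁻¹) fun h v => by
      simp only [LinearMap.sum_apply, LinearMap.comp_apply, map_sum]
      refine Fintype.sum_bijective (h⁻¹ * ·) (Group.mulLeft_bijective h⁻¹) _ _ fun g => ?_
      rw [← Module.End.mul_apply, ← Module.End.mul_apply, ← map_mul, ← map_mul]
      simp
  map_add' φ ψ := by
    ext v
    simp [LinearMap.comp_add, LinearMap.add_comp, Finset.sum_add_distrib]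
  map_smul' c φ := by
    ext v
    simp [Finset.smul_sum]

lemma transfer_apply (φ : X →ₗ[k] Y) (v : X) :
    transfer ρ σ φ v = ∑ g : G, σ g (φ (ρ g⁻¹ v)) := by
  simp [transfer, LinearMap.sum_apply]

variable {ρ σ τ υ}

lemma comp_transfer (f : σ.IntertwiningMap τ) (φ : X →ₗ[k] Y) :
    f.comp (transfer ρ σ φ) = transfer ρ τ (f.toLinearMap ∘ₗ φ) := by
  ext v
  simp [IntertwiningMap.toLinearMap_apply, transfer_apply, f.isIntertwining]

lemma transfer_comp (f : ρ.IntertwiningMap σ) (φ : Y →ₗ[k] Z) :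
    (transfer σ τ φ).comp f = transfer ρ τ (φ ∘ₗ f.toLinearMap) := by
  ext v
  simp [IntertwiningMap.toLinearMap_apply, transfer_apply, f.isIntertwining]

lemma lTensor_transfer (φ : X →ₗ[k] Y) :
    (transfer ρ σ φ).lTensor τ = transfer (τ.tprod ρ) (τ.tprod σ) (φ.lTensor Z) := by
  ext z x
  simp [IntertwiningMap.toLinearMap_apply, transfer_apply, TensorProduct.tmul_sum]

lemma rTensor_transfer (φ : X →ₗ[k] Y) :
    (transfer ρ σ φ).rTensor τ = transfer (ρ.tprod τ) (σ.tprod τ) (φ.rTensor Z) := by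
  ext z x
  simp [IntertwiningMap.toLinearMap_apply, transfer_apply, TensorProduct.sum_tmul]

lemma trace_transfer [Module.Finite k X] (φ : X →ₗ[k] X) :
    LinearMap.trace k X (transfer ρ ρ φ).toLinearMap = Nat.card G * LinearMap.trace k X φ := by
  have h : (transfer ρ ρ φ).toLinearMap = ∑ g : G, ρ g ∘ₗ φ ∘ₗ ρ g⁻¹ := rfl
  rw [h, map_sum]
  have h2 (g : G) : LinearMap.trace k X (ρ g ∘ₗ φ ∘ₗ ρ g⁻¹) = LinearMap.trace k X φ := by
    rw [LinearMap.trace_comp_comm', LinearMap.comp_assoc]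
    have : ρ g⁻¹ ∘ₗ ρ g = LinearMap.id := by
      rw [← Module.End.mul_eq_comp, ← map_mul]; simp; rfl
    rw [this, LinearMap.comp_id]
  simp [h2]

/-- On a free module the identity is the relative trace of the projection onto the coefficients at 1
∈ G. This is the free case of Higman's criterion. -/
lemma sum_single_smul_coeff_one {M : Type*} (f : M →₀ MonoidAlgebra k G) :
    ∑ g : G, MonoidAlgebra.single g (1 : k) • Finsupp.mapRange.linearMap
      (MonoidAlgebra.lsingle (R := k) 1 ∘ₗ Finsupp.lapply (R := k) 1 ∘ₗ
        (MonoidAlgebra.coeffLinearEquiv (M := G) (S := k) k).toLinearMap)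
      (MonoidAlgebra.single g⁻¹ (1 : k) • f) = f := by
  classical
  induction f using Finsupp.induction_linear with
  | zero => simp
  | add f g hf hg =>
    simp only [smul_add, map_add, Finset.sum_add_distrib, hf, hg]
  | single x a =>
    induction a using MonoidAlgebra.induction_linear with
    | zero => simp
    | add a b ha hb =>
      simp only [Finsupp.single_add, smul_add, map_add, Finset.sum_add_distrib, ha, hb]
    | single h r =>
      rw [Finset.sum_eq_single h]
      · simp [MonoidAlgebra.single_mul_single]
      · intro g _ hg
        have : g⁻¹ * h ≠ 1 := by simpa [inv_mul_eq_one] using hg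
        simp [MonoidAlgebra.single_mul_single, this]
      · simp

variable (ρ) in
/-- Higman's criterion: a representation over a field is projective if and only if its identity
is a relative trace. -/
theorem isProjective_iff :
    IsProjective ρ ↔ ∃ φ : X →ₗ[k] X, transfer ρ ρ φ = IntertwiningMap.id ρ := by
  constructor
  · rintro ⟨s, hs⟩
    -- A projective module is a retract of a free one, via s and L; the relative trace expressing
    -- the identity of the free module is carried through this retraction.
    let κ := Finsupp.mapRange.linearMap (α := ρ.asModule)
      (MonoidAlgebra.lsingle (R := k) (1 : G) ∘ₗ Finsupp.lapply (R := k) 1 ∘ₗ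
        (MonoidAlgebra.coeffLinearEquiv (M := G) (S := k) k).toLinearMap)
    let L := Finsupp.linearCombination (MonoidAlgebra k G) (_root_.id : ρ.asModule → ρ.asModule)
    refine ⟨ρ.asModuleEquiv.toLinearMap ∘ₗ L.restrictScalars k ∘ₗ κ ∘ₗ s.restrictScalars k ∘ₗ
      ρ.asModuleEquiv.symm.toLinearMap, ?_⟩
    ext v
    have key (g : G) : ρ g (L (κ (s (ρ.asModuleEquiv.symm (ρ g⁻¹ v))))) =
        L (MonoidAlgebra.single g (1 : k) •
          κ (MonoidAlgebra.single g⁻¹ (1 : k) • s (ρ.asModuleEquiv.symm v))) := by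
      rw [← map_smul s, map_smul L, single_smul_asModule, single_smul_asModule]
      rfl
    refine (transfer_apply ρ ρ _ v).trans ?_
    refine (Finset.sum_congr rfl fun g _ => key g).trans ?_
    exact (map_sum L _ _).symm.trans ((congrArg L (sum_single_smul_coeff_one _)).trans (hs _))
  · rintro ⟨φ, hφ⟩
    refine Module.Projective.of_lifting_property'' fun f hf => ?_
    obtain ⟨s, hs⟩ := LinearMap.exists_rightInverse_of_surjective (f.restrictScalars k)
      (LinearMap.range_eq_top.2 hf)
    -- A k-linear section s need not be equivariant, but the relative trace of s ∘ φ is, and f sends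
    -- it to the relative trace of φ, which is the identity.
    let ψ : ρ.asModule →ₗ[k] ρ.asModule →₀ MonoidAlgebra k G := s ∘ₗ
      (ρ.asModuleEquiv.symm.toLinearMap ∘ₗ φ ∘ₗ ρ.asModuleEquiv.toLinearMap)
    refine ⟨ψ.sumOfConjugatesEquivariant G, LinearMap.ext fun v => ?_⟩
    rw [LinearMap.comp_apply, LinearMap.sumOfConjugatesEquivariant_apply, map_sum]
    have hs' (w : ρ.asModule) : f (s w) = w := LinearMap.congr_fun hs w
    have hv : ∑ g : G, ρ g (φ (ρ g⁻¹ (ρ.asModuleEquiv v))) = ρ.asModuleEquiv v := by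
      rw [← transfer_apply, hφ]
      rfl
    refine Eq.trans ?_ hv
    -- `LinearMap.conjugate` places g⁻¹ on the outside, while `transfer` places g there.
    refine Fintype.sum_bijective (·⁻¹) (Equiv.inv G).bijective _ _ fun g => ?_
    rw [LinearMap.conjugate_apply, map_smul, single_smul_asModule, inv_inv]
    simp only [ψ, LinearMap.comp_apply]
    rw [hs', single_smul_asModule]
    rfl

/-- Intertwining maps modulo relative traces. -/
abbrev StableHom (ρ : Representation k G X) (σ : Representation k G Y) : Type _ :=
  ρ.IntertwiningMap σ ⧸ LinearMap.range (transfer ρ σ)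

/-- Post-composition on stable maps. -/
def stablePostcomp (ρ : Representation k G X) (f : σ.IntertwiningMap τ) :
    StableHom ρ σ →ₗ[k] StableHom ρ τ :=
  Submodule.mapQ _ _ (IntertwiningMap.llcomp ρ σ τ f) <| by
    rintro _ ⟨φ, rfl⟩
    exact ⟨f.toLinearMap ∘ₗ φ, (comp_transfer f φ).symm⟩

lemma stablePostcomp_mk (f : σ.IntertwiningMap τ) (x : ρ.IntertwiningMap σ) :
    stablePostcomp ρ f (Submodule.Quotient.mk x) = Submodule.Quotient.mk (f.comp x) := rfl

lemma stablePostcomp_comp (f : τ.IntertwiningMap υ) (g : σ.IntertwiningMap τ) :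
    stablePostcomp ρ (f.comp g) = stablePostcomp ρ f ∘ₗ stablePostcomp ρ g := by
  refine LinearMap.ext fun x => ?_
  induction x using Submodule.Quotient.induction_on
  rfl

lemma stablePostcomp_id : stablePostcomp ρ (.id σ) = LinearMap.id := by
  refine LinearMap.ext fun x => ?_
  induction x using Submodule.Quotient.induction_on
  rfl

lemma stablePostcomp_zero : stablePostcomp ρ (0 : σ.IntertwiningMap τ) = 0 := by
  refine LinearMap.ext fun x => ?_
  induction x using Submodule.Quotient.induction_on
  rfl

lemma stablePostcomp_add (f g : σ.IntertwiningMap τ) :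
    stablePostcomp ρ (f + g) = stablePostcomp ρ f + stablePostcomp ρ g := by
  refine LinearMap.ext fun x => ?_
  induction x using Submodule.Quotient.induction_on
  rfl

/-- The dimension of the space of stable maps. -/
noncomputable def stableRank (ρ : Representation k G X) (σ : Representation k G Y) : ℕ :=
  Module.finrank k (StableHom ρ σ)

/-- Stable Hom out of ρ is an additive functor, so it turns the biproduct identities into mutually
inverse linear maps. -/
lemma IsBiproduct.stableRank_eq [Module.Finite k X] [Module.Finite k Y] [Module.Finite k T]
    (h : IsBiproduct τ σ υ) (ρ : Representation k G X) :
    stableRank ρ τ = stableRank ρ σ + stableRank ρ υ := by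
  obtain ⟨i, q, i', q', h₁, h₂, h₃, h₄, h₅⟩ := h
  unfold stableRank
  rw [← Module.finrank_prod]
  refine LinearEquiv.finrank_eq (LinearEquiv.ofLinearMap
    ((stablePostcomp ρ q).prod (stablePostcomp ρ q'))
    ((stablePostcomp ρ i).coprod (stablePostcomp ρ i')) ?_ ?_)
  · rw [LinearMap.prod_comp, LinearMap.comp_coprod, LinearMap.comp_coprod]
    simp only [← stablePostcomp_comp, h₁, h₂, h₃, h₄, stablePostcomp_id, stablePostcomp_zero]
    ext <;> simp
  · rw [LinearMap.coprod_comp_prod]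
    simp only [← stablePostcomp_comp, ← stablePostcomp_add, h₅, stablePostcomp_id]

lemma stableRank_congr (e : σ.Equiv τ) (ρ : Representation k G X) :
    stableRank ρ σ = stableRank ρ τ := by
  refine LinearEquiv.finrank_eq (LinearEquiv.ofLinearMap (stablePostcomp ρ e.toIntertwiningMap)
    (stablePostcomp ρ e.symm.toIntertwiningMap) ?_ ?_)
  all_goals rw [← stablePostcomp_comp, ← stablePostcomp_id]
  · exact congrArg _ (congrArg Equiv.toIntertwiningMap e.symm_trans)
  · exact congrArg _ (congrArg Equiv.toIntertwiningMap e.trans_symm)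

/-- Relative traces form an ideal: if the identity of σ is one, so is every map into σ. -/
lemma stableRank_eq_zero {φ : Y →ₗ[k] Y} (h : transfer σ σ φ = .id σ)
    (ρ : Representation k G X) : stableRank ρ σ = 0 := by
  have : Subsingleton (StableHom ρ σ) := by
    refine Submodule.Quotient.subsingleton_iff.2 (eq_top_iff.2 fun f _ => ?_)
    refine ⟨φ ∘ₗ f.toLinearMap, ?_⟩
    rw [← transfer_comp, h]
    rfl
  exact Module.finrank_zero_of_subsingleton

/-- The intertwining maps that are sums of relative traces and of maps factoring through one of
the representations `σ i`. -/
def stableIdeal {ι : Type*} {W : ι → Type*} [∀ i, AddCommGroup (W i)] [∀ i, Module k (W i)]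
    (σ : ∀ i, Representation k G (W i)) (ρ : Representation k G X) (τ : Representation k G Y) :
    Submodule k (ρ.IntertwiningMap τ) :=
  Submodule.span k ({f | ∃ i, ∃ (a : ρ.IntertwiningMap (σ i)) (b : (σ i).IntertwiningMap τ),
    f = b.comp a} ∪ {f | ∃ φ, f = transfer ρ τ φ})

section StableIdeal

variable {ι : Type*} {W : ι → Type*} [∀ i, AddCommGroup (W i)] [∀ i, Module k (W i)]
  {S : ∀ i, Representation k G (W i)}

lemma comp_mem_stableIdeal {i : ι} (b : (S i).IntertwiningMap σ) (a : ρ.IntertwiningMap (S i)) :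
    b.comp a ∈ stableIdeal S ρ σ :=
  Submodule.subset_span (.inl ⟨i, a, b, rfl⟩)

lemma transfer_mem_stableIdeal (φ : X →ₗ[k] Y) : transfer ρ σ φ ∈ stableIdeal S ρ σ :=
  Submodule.subset_span (.inr ⟨φ, rfl⟩)

lemma stableIdeal_postcomp (f : σ.IntertwiningMap τ) {x : ρ.IntertwiningMap σ}
    (hx : x ∈ stableIdeal S ρ σ) : f.comp x ∈ stableIdeal S ρ τ := by
  have : stableIdeal S ρ σ ≤ (stableIdeal S ρ τ).comap (IntertwiningMap.llcomp ρ σ τ f) := by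
    refine Submodule.span_le.2 ?_
    rintro _ (⟨i, a, b, rfl⟩ | ⟨φ, rfl⟩)
    · exact comp_mem_stableIdeal (f.comp b) a
    · change f.comp _ ∈ stableIdeal S ρ τ
      rw [comp_transfer]
      exact transfer_mem_stableIdeal _
  exact this hx

lemma stableIdeal_precomp (f : ρ.IntertwiningMap σ) {x : σ.IntertwiningMap τ}
    (hx : x ∈ stableIdeal S σ τ) : x.comp f ∈ stableIdeal S ρ τ := by
  have : stableIdeal S σ τ ≤ (stableIdeal S ρ τ).comap
      ((IntertwiningMap.llcomp ρ σ τ).flip f) := by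
    refine Submodule.span_le.2 ?_
    rintro _ (⟨i, a, b, rfl⟩ | ⟨φ, rfl⟩)
    · exact comp_mem_stableIdeal b (a.comp f)
    · change IntertwiningMap.comp _ f ∈ stableIdeal S ρ τ
      rw [transfer_comp]
      exact transfer_mem_stableIdeal _
  exact this hx

lemma mem_stableIdeal_of_id_mem' (h : .id σ ∈ stableIdeal S σ σ) (x : ρ.IntertwiningMap σ) :
    x ∈ stableIdeal S ρ σ :=
  stableIdeal_precomp x h

lemma IsBiproduct.id_mem_stableIdeal (h : IsBiproduct τ σ υ)
    (hσ : .id σ ∈ stableIdeal S σ σ) (hυ : .id υ ∈ stableIdeal S υ υ) :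
    .id τ ∈ stableIdeal S τ τ := by
  obtain ⟨i, q, i', q', -, -, -, -, h⟩ := h
  rw [← h]
  exact add_mem (stableIdeal_postcomp i (stableIdeal_precomp q hσ))
    (stableIdeal_postcomp i' (stableIdeal_precomp q' hυ))

lemma id_mem_stableIdeal_of_isSummand (h : IsSummand σ τ) (hτ : .id τ ∈ stableIdeal S τ τ) :
    .id σ ∈ stableIdeal S σ σ := by
  obtain ⟨i, r, h⟩ := h
  rw [← h]
  exact stableIdeal_postcomp r (stableIdeal_precomp i hτ)

/-- After tensoring, a map through S i factors through ρ ⊗ S i, whose identity lies in the ideal by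
hypothesis; a relative trace remains a relative trace. -/
lemma lTensor_mem_stableIdeal (h : ∀ i, .id (ρ.tprod (S i)) ∈ stableIdeal S (ρ.tprod (S i)) _)
    {x : σ.IntertwiningMap τ} (hx : x ∈ stableIdeal S σ τ) :
    x.lTensor ρ ∈ stableIdeal S (ρ.tprod σ) (ρ.tprod τ) := by
  induction hx using Submodule.span_induction with
  | mem x hx =>
    obtain ⟨i, a, b, rfl⟩ | ⟨φ, rfl⟩ := hx
    · rw [lTensor_comp]
      exact stableIdeal_postcomp _ (mem_stableIdeal_of_id_mem' (h i) _)
    · rw [lTensor_transfer]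
      exact transfer_mem_stableIdeal _
  | zero => simp
  | add x y _ _ hx hy => simpa using add_mem hx hy
  | smul c x _ hx => simpa using Submodule.smul_mem _ c hx

end StableIdeal

end Transfer

/-! ### Fitting's lemma and identification of the indecomposable summands -/

section Fitting

variable {k G : Type*} [Field k] [Group G]
variable {X : Type*} [AddCommGroup X] [Module k X] [Module.Finite k X]
  {ρ : Representation k G X}

/-- Fitting's lemma: an endomorphism of an indecomposable finite-dimensional representation is
nilpotent or invertible. -/
lemma IsIndecomposable.isNilpotent_or_bijective (h : IsIndecomposable ρ)
    (a : ρ.IntertwiningMap ρ) : IsNilpotent a.toLinearMap ∨ Function.Bijective a := by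
  -- Kernel and range of a high power are complementary and stable under G. The condition n ≥ 1 lets
  -- injectivity of the power pass down to a.
  obtain ⟨n, hn, hn0⟩ := ((LinearMap.eventually_isCompl_ker_pow_range_pow a.toLinearMap).and
    (Filter.eventually_ge_atTop 1)).exists
  have hpow : (a ^ n).toLinearMap = a.toLinearMap ^ n := by
    clear hn hn0
    induction n with
    | zero => rfl
    | succ n ih => rw [pow_succ, pow_succ, IntertwiningMap.coe_mul, ih]
  rw [← hpow] at hn
  have hc : IsCompl (a ^ n).ker (a ^ n).range := by
    refine ⟨disjoint_iff.2 (Subrepresentation.toSubmodule_injective ?_),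
      codisjoint_iff.2 (Subrepresentation.toSubmodule_injective ?_)⟩
    · exact disjoint_iff.1 hn.1
    · exact codisjoint_iff.1 hn.2
  obtain h0 | h0 := h.2 _ _ hc
  · right
    have hker : LinearMap.ker (a ^ n).toLinearMap = ⊥ := congrArg Subrepresentation.toSubmodule h0
    rw [hpow] at hker
    obtain ⟨m, rfl⟩ := Nat.exists_eq_add_of_le' hn0
    have hinj : Function.Injective a.toLinearMap := by
      rw [LinearMap.ker_eq_bot, pow_succ, Module.End.coe_mul] at hker
      exact hker.of_comp
    exact ⟨hinj, LinearMap.injective_iff_surjective.1 hinj⟩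
  · left
    have hr : LinearMap.range (a ^ n).toLinearMap = ⊥ :=
      congrArg Subrepresentation.toSubmodule h0
    exact ⟨n, by rw [← hpow, ← LinearMap.range_eq_bot, hr]⟩

/-- This is locality of the endomorphism ring: once the sum is normalised to 1, if the first term is
nilpotent the second is 1 minus a nilpotent, hence a unit. -/
lemma IsIndecomposable.bijective_of_add (h : IsIndecomposable ρ) {a b : ρ.IntertwiningMap ρ}
    (hab : Function.Bijective (a + b)) : Function.Bijective a ∨ Function.Bijective b := by
  set e := ((a + b).ofBijective hab).symm with he
  have hsum (v : X) : e (a v) + e (b v) = v := by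
    rw [← map_add]
    exact Representation.Equiv.symm_apply_apply ((a + b).ofBijective hab) v
  refine (h.isNilpotent_or_bijective (e.toIntertwiningMap.comp a)).symm.imp (fun ha => ?_)
    fun ha => ?_
  · exact (Function.Bijective.of_comp_iff' (EquivLike.bijective e) a).1 ha
  · have hb : (e.toIntertwiningMap.comp b).toLinearMap =
        1 - (e.toIntertwiningMap.comp a).toLinearMap := by
      refine LinearMap.ext fun v => ?_
      exact eq_sub_of_add_eq' (hsum v)
    have hu := (Module.End.isUnit_iff _).1 ha.isUnit_one_sub
    rw [← hb] at hu
    exact (Function.Bijective.of_comp_iff' (EquivLike.bijective e) b).1 hu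

variable [Fintype G] {ι : Type*} {W : ι → Type*} [∀ i, AddCommGroup (W i)]
  [∀ i, Module k (W i)] {S : ∀ i, Representation k G (W i)}

/-- A non-projective indecomposable representation whose identity is stably a sum of maps factoring
through representations `S i` with scalar endomorphisms is isomorphic to some `S i`. -/
theorem IsIndecomposable.exists_equiv (h : IsIndecomposable ρ) (hp : ¬ IsProjective ρ)
    (hS : ∀ i (f : (S i).IntertwiningMap (S i)), ∃ c : k, f = c • .id (S i))
    (hid : .id ρ ∈ stableIdeal S ρ ρ) : ∃ i, Nonempty (ρ.Equiv (S i)) := by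
  -- By locality, a bijective element of the span forces one of the spanning maps to be bijective;
  -- applied at the end to the identity.
  have key (x) (hx : x ∈ stableIdeal S ρ ρ) :
      Function.Bijective x → ∃ i, Nonempty (ρ.Equiv (S i)) := by
    have := h.1
    induction hx using Submodule.span_induction with
    | mem x hx =>
      intro hb
      set e := (x.ofBijective hb).symm.toIntertwiningMap with he
      have hex (v : X) : e (x v) = v := Representation.Equiv.symm_apply_apply (x.ofBijective hb) v
      obtain ⟨i, a, b, rfl⟩ | ⟨φ, rfl⟩ := hx
      -- The maps e ∘ b and a compose to the identity in one order and to the scalar c in the other.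
      -- So c ≠ 0 and a is an isomorphism onto S i.
      · obtain ⟨c, hc⟩ := hS i (a.comp (e.comp b))
        have hc' (v : W i) : a (e (b v)) = c • v := DFunLike.congr_fun hc v
        have hex' (v : X) : e (b (a v)) = v := hex v
        have hc0 : c ≠ 0 := by
          rintro rfl
          obtain ⟨v, hv⟩ := exists_ne (0 : X)
          apply hv
          rw [← hex' v, ← hex' v, hc', zero_smul, map_zero, map_zero]
        refine ⟨i, ⟨a.ofBijective ⟨?_, ?_⟩⟩⟩
        · exact Function.LeftInverse.injective (g := fun w => e (b w)) hex'
        · intro w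
          exact ⟨c⁻¹ • e (b w), by rw [map_smul, hc', smul_smul, inv_mul_cancel₀ hc0, one_smul]⟩
      · refine absurd ((isProjective_iff ρ).2 ⟨e.toLinearMap ∘ₗ φ, ?_⟩) hp
        rw [← comp_transfer]
        ext v
        exact hex v
    | zero =>
      intro hb
      obtain ⟨v, hv⟩ := exists_ne (0 : X)
      exact absurd (hb.1 (by simp : (0 : ρ.IntertwiningMap ρ) v = (0 : ρ.IntertwiningMap ρ) 0)) hv
    | add x y _ _ hx hy => exact fun hb => (h.bijective_of_add hb).elim hx hy
    | smul c x _ hx =>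
      intro hb
      refine hx ?_
      have hc : c ≠ 0 := by
        rintro rfl
        obtain ⟨v, hv⟩ := exists_ne (0 : X)
        exact absurd (hb.1 (by simp : ((0 : k) • x) v = ((0 : k) • x) 0)) hv
      have hx' : ⇑x = (c⁻¹ • ·) ∘ ⇑(c • x) := by
        ext v
        simp [smul_smul, hc]
      rw [hx']
      exact ((MulAction.bijective₀ (inv_ne_zero hc))).comp hb
  exact key _ hid Function.bijective_id

end Fitting

/-! ### Multiplicities as dimensions of stable Hom -/

section Multiplicity

variable {k G : Type*} [Field k] [Group G]
variable {X Y : Type*} [AddCommGroup X] [Module k X] [AddCommGroup Y] [Module k Y]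
  {ρ : Representation k G X} {σ : Representation k G Y}

lemma exists_orthogonal_of_isSummand_directSum {m : ℕ}
    (h : IsSummand (Representation.directSum fun _ : Fin m => σ) ρ) :
    ∃ (i : Fin m → σ.IntertwiningMap ρ) (r : Fin m → ρ.IntertwiningMap σ),
      ∀ a b, (r b).comp (i a) = if a = b then .id σ else 0 := by
  obtain ⟨i, r, h⟩ := h
  refine ⟨fun a => i.comp (directSumIncl σ m a), fun b => (directSumProj σ m b).comp r,
    fun a b => ?_⟩
  have : ((directSumProj σ m b).comp r).comp (i.comp (directSumIncl σ m a)) =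
    (directSumProj σ m b).comp ((r.comp i).comp (directSumIncl σ m a)) := rfl
  rw [this, h, ← directSumProj_comp_incl]
  rfl

lemma isSummand_of_multiplicity_ne_zero (h : multiplicity ρ σ ≠ 0) : IsSummand σ ρ := by
  have : ∃ m ∈ {m : ℕ | IsSummand (Representation.directSum fun _ : Fin m => σ) ρ}, m ≠ 0 := by
    by_contra! hm
    exact h (Nat.le_zero.1 (csSup_le' fun m hm' => (hm m hm').le))
  obtain ⟨m, hm, hm0⟩ := this
  obtain ⟨i, r, h⟩ := exists_orthogonal_of_isSummand_directSum hm
  let a : Fin m := ⟨0, by omega⟩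
  exact ⟨i a, r a, by simp [h]⟩

lemma multiplicity_congr {Z : Type*} [AddCommGroup Z] [Module k Z] {τ : Representation k G Z}
    (e : σ.Equiv τ) : multiplicity ρ σ = multiplicity ρ τ := by
  unfold multiplicity
  congr 1
  ext m
  exact ⟨(isSummand_directSum (isSummand_of_equiv e.symm) m).trans,
    (isSummand_directSum (isSummand_of_equiv e) m).trans⟩

lemma isSummand_directSum_one (h : IsSummand σ ρ) :
    IsSummand (Representation.directSum fun _ : Fin 1 => σ) ρ := by
  refine IsSummand.trans ⟨directSumProj σ 1 0, directSumIncl σ 1 0, ?_⟩ h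
  refine IntertwiningMap.ext (DirectSum.linearMap_ext k fun i => LinearMap.ext fun v => ?_)
  obtain rfl : i = 0 := Subsingleton.elim _ _
  change DirectSum.lof k _ _ _ (DirectSum.component k _ _ _ (DirectSum.lof k _ _ _ _)) = _
  rw [DirectSum.component.lof_self]
  rfl

variable [Fintype G] {ι : Type*} {W : ι → Type*} [∀ i, AddCommGroup (W i)]
  [∀ i, Module k (W i)] {S : ∀ i, Representation k G (W i)}

/-- If S j is not a summand, every composite S j → ρ → S j is a scalar that cannot be invertible,
hence 0. Composites into the other S i vanish as well, so writing the identity of ρ in the ideal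
makes every map S j → ρ a relative trace. -/
theorem isSummand_of_stableRank_ne_zero
    (hS : ∀ i (f : (S i).IntertwiningMap (S i)), ∃ c : k, f = c • .id (S i))
    (hS' : ∀ i j (f : (S i).IntertwiningMap (S j)), i ≠ j → f = 0)
    (hid : .id ρ ∈ stableIdeal S ρ ρ) {j : ι} (h : stableRank (S j) ρ ≠ 0) :
    IsSummand (S j) ρ := by
  by_contra hns
  have hzero (r : ρ.IntertwiningMap (S j)) (x : (S j).IntertwiningMap ρ) : r.comp x = 0 := by
    obtain ⟨c, hc⟩ := hS j (r.comp x)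
    obtain rfl | hc0 := eq_or_ne c 0
    · rw [hc, zero_smul]
    · refine absurd ⟨x, c⁻¹ • r, ?_⟩ hns
      rw [IntertwiningMap.smul_comp, hc, smul_smul, inv_mul_cancel₀ hc0, one_smul]
  have key (x : (S j).IntertwiningMap ρ) (F) (hF : F ∈ stableIdeal S ρ ρ) :
      F.comp x ∈ LinearMap.range (transfer (S j) ρ) := by
    induction hF using Submodule.span_induction with
    | mem F hF =>
      obtain ⟨i, a, b, rfl⟩ | ⟨φ, rfl⟩ := hF
      · have h0 : a.comp x = 0 := by
          obtain rfl | hij := eq_or_ne j i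
          · exact hzero a x
          · exact hS' _ _ _ hij
        have : (b.comp a).comp x = b.comp (a.comp x) := rfl
        have hb : b.comp (0 : (S j).IntertwiningMap (S i)) = 0 := by
          ext v
          simp
        rw [this, h0, hb]
        exact zero_mem _
      · rw [transfer_comp]
        exact ⟨_, rfl⟩
    | zero => exact zero_mem _
    | add F F' _ _ hF hF' => exact add_mem hF hF'
    | smul c F _ hF => exact Submodule.smul_mem _ c hF
  apply h
  have : Subsingleton (StableHom (S j) ρ) :=
    Submodule.Quotient.subsingleton_iff.2 (eq_top_iff.2 fun x _ => key x _ hid)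
  exact Module.finrank_zero_of_subsingleton

variable [Module.Finite k X] [Module.Finite k Y] [∀ i, Module.Finite k (W i)]

/-- The inclusions of the m copies are linearly independent in stable Hom: the projections separate
them, and the identity of σ is not stably zero. -/
lemma le_stableRank_of_isSummand {m : ℕ} (hσ : stableRank σ σ ≠ 0)
    (h : IsSummand (Representation.directSum fun _ : Fin m => σ) ρ) : m ≤ stableRank σ ρ := by
  obtain ⟨i, r, h⟩ := exists_orthogonal_of_isSummand_directSum h
  have hid : (Submodule.Quotient.mk (.id σ) : StableHom σ σ) ≠ 0 := by
    intro h0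
    obtain ⟨φ, hφ⟩ := (Submodule.Quotient.mk_eq_zero _).1 h0
    exact hσ (stableRank_eq_zero hφ σ)
  have hli : LinearIndependent k fun a => (Submodule.Quotient.mk (i a) : StableHom σ ρ) := by
    rw [Fintype.linearIndependent_iff]
    intro c hc b
    have := congrArg (stablePostcomp σ (r b)) hc
    simp only [map_sum, map_smul, stablePostcomp_mk, h, map_zero] at this
    rw [Finset.sum_eq_single b] at this
    · simpa [hid] using this
    · intro a _ hab
      simp [hab]
    · simp
  simpa [stableRank] using hli.fintype_card_le_finrank

theorem multiplicity_eq_stableRank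
    (hS : ∀ i (f : (S i).IntertwiningMap (S i)), ∃ c : k, f = c • .id (S i))
    (hS' : ∀ i j (f : (S i).IntertwiningMap (S j)), i ≠ j → f = 0)
    (hid : .id ρ ∈ stableIdeal S ρ ρ) {j : ι} (hj : stableRank (S j) (S j) ≠ 0)
    (h : stableRank (S j) ρ ≤ 1) : multiplicity ρ (S j) = stableRank (S j) ρ := by
  -- The bound also guards against the default value of `sSup`, which is 0 on an unbounded set of
  -- naturals.
  have hbdd : ∀ m ∈ {m : ℕ | IsSummand (Representation.directSum fun _ : Fin m => S j) ρ},
      m ≤ stableRank (S j) ρ := fun m hm => le_stableRank_of_isSummand hj hm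
  refine le_antisymm (csSup_le' hbdd) ?_
  obtain h0 | h0 := Nat.eq_zero_or_pos (stableRank (S j) ρ)
  · omega
  · have h1 : stableRank (S j) ρ = 1 := by omega
    rw [h1]
    exact le_csSup ⟨_, hbdd⟩
      (isSummand_directSum_one (isSummand_of_stableRank_ne_zero hS hS' hid h0.ne'))

end Multiplicity

/-! ### Binary forms and Schur's lemma for V_1, …, V_p -/

section SL2Modules

variable (k : Type u) [Field k] (p : ℕ) [CharP k p]

/-- The space of binary forms of degree `d`. -/
abbrev Forms (d : ℕ) : Submodule k (MvPolynomial (Fin 2) k) :=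
  MvPolynomial.homogeneousSubmodule (Fin 2) k d

lemma coe_homogRep (n : ℕ) (g : SL2 p) (f : Forms k (n - 1)) :
    (homogRep k p n g f : MvPolynomial (Fin 2) k) = substHom k p g f := rfl

/-- The monomial `X ^ (d - a) * Y ^ a`, for `a ≤ d`, and `0` otherwise. -/
noncomputable def mono (d a : ℕ) : Forms k d :=
  if h : a ≤ d then ⟨MvPolynomial.X 0 ^ (d - a) * MvPolynomial.X 1 ^ a, by
    have h1 := ((MvPolynomial.isHomogeneous_X k (0 : Fin 2)).pow (d - a)).mul
      ((MvPolynomial.isHomogeneous_X k (1 : Fin 2)).pow a)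
    rwa [one_mul, one_mul, Nat.sub_add_cancel h] at h1⟩ else 0

variable {k} in
lemma coe_mono {d a : ℕ} (h : a ≤ d) :
    (mono k d a : MvPolynomial (Fin 2) k) = MvPolynomial.X 0 ^ (d - a) * MvPolynomial.X 1 ^ a := by
  rw [mono, dif_pos h]

lemma coeff_mono {d a b : ℕ} (ha : a ≤ d) :
    MvPolynomial.coeff (Finsupp.single 0 (d - b) + Finsupp.single 1 b) (mono k d a).1 =
      if a = b then 1 else 0 := by
  rw [coe_mono ha, MvPolynomial.X_pow_eq_monomial, MvPolynomial.X_pow_eq_monomial,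
    MvPolynomial.monomial_mul, MvPolynomial.coeff_monomial, one_mul]
  refine if_congr ⟨fun h => ?_, fun h => by rw [h]⟩ rfl rfl
  simpa using DFunLike.congr_fun h 1

lemma eq_sum_mono {d : ℕ} (f : Forms k d) :
    f = ∑ a : Fin (d + 1),
      MvPolynomial.coeff (Finsupp.single 0 (d - a) + Finsupp.single 1 (a : ℕ)) f.1 • mono k d a := by
  refine Subtype.ext (MvPolynomial.ext _ _ fun m => ?_)
  rw [Submodule.coe_sum, MvPolynomial.coeff_sum]
  simp only [Submodule.coe_smul, MvPolynomial.coeff_smul]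
  by_cases hm : m.degree = d
  · have hm' : m 0 + m 1 = d := by
      rw [← hm, Finsupp.degree_eq_sum, Fin.sum_univ_two]
    have hm2 : m = Finsupp.single 0 (d - m 1) + Finsupp.single 1 (m 1) := by
      ext i
      fin_cases i
      · simp
        omega
      · simp
    rw [Finset.sum_eq_single (⟨m 1, by omega⟩ : Fin (d + 1))]
    · have h1 := coeff_mono k (d := d) (a := m 1) (b := m 1) (by omega)
      rw [← hm2, if_pos rfl] at h1
      change _ = MvPolynomial.coeff (Finsupp.single 0 (d - m 1) + Finsupp.single 1 (m 1)) f.1 •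
        MvPolynomial.coeff m (mono k d (m 1)).1
      rw [h1, ← hm2, smul_eq_mul, mul_one]
    · intro a _ ha
      have h1 := coeff_mono k (b := m 1) (Nat.lt_succ_iff.1 a.2)
      rw [← hm2, if_neg fun h => ha (Fin.ext h)] at h1
      rw [h1, smul_zero]
    · simp
  · rw [MvPolynomial.IsHomogeneous.coeff_eq_zero f.2 hm]
    refine (Finset.sum_eq_zero fun a _ => ?_).symm
    rw [MvPolynomial.IsHomogeneous.coeff_eq_zero (mono k d a).2 hm, smul_zero]

/-- The monomial basis of the space of binary forms. -/
noncomputable def formsBasis (d : ℕ) : Module.Basis (Fin (d + 1)) k (Forms k d) :=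
  Module.Basis.mk (v := fun a : Fin (d + 1) => mono k d a)
    (by
      rw [Fintype.linearIndependent_iff]
      intro c hc b
      have := congrArg (fun f : Forms k d => MvPolynomial.coeff
        (Finsupp.single 0 (d - b) + Finsupp.single 1 (b : ℕ)) f.1) hc
      simp only [Submodule.coe_sum, MvPolynomial.coeff_sum, Submodule.coe_smul,
        MvPolynomial.coeff_smul] at this
      rw [Finset.sum_congr rfl fun a _ => by
        rw [coeff_mono k (Nat.lt_succ_iff.1 a.2)]] at this
      simpa [Fin.val_inj] using this)
    (by
      rintro f -
      rw [eq_sum_mono k f]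
      exact Submodule.sum_mem _ fun a _ => Submodule.smul_mem _ _
        (Submodule.subset_span ⟨a, rfl⟩))

lemma formsBasis_apply (d : ℕ) (a : Fin (d + 1)) : formsBasis k d a = mono k d a := by
  simp [formsBasis]

lemma finrank_forms (d : ℕ) : Module.finrank k (Forms k d) = d + 1 := by
  rw [Module.finrank_eq_card_basis (formsBasis k d), Fintype.card_fin]

lemma forms_hom_ext {d : ℕ} {E : Type*} [AddCommMonoid E] [Module k E] {F F' : Forms k d →ₗ[k] E}
    (h : ∀ a ≤ d, F (mono k d a) = F' (mono k d a)) : F = F' :=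
  (formsBasis k d).ext fun a => by
    rw [formsBasis_apply]
    exact h a (Nat.lt_succ_iff.1 a.2)

/-- Vandermonde at the points 0, …, N - 1, which stay distinct in k because N ≤ p; functionals
reduce the vector case to scalars. -/
lemma eq_zero_of_sum_natCast_pow_smul_eq_zero {E : Type*} [AddCommGroup E] [Module k E] {N : ℕ}
    (hN : N ≤ p) {v : ℕ → E} (h : ∀ s : ℕ, ∑ a ∈ Finset.range N, (s : k) ^ a • v a = 0) {a : ℕ}
    (ha : a < N) : v a = 0 := by
  have hinj : Function.Injective fun s : Fin N => ((s : ℕ) : k) := by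
    intro s t hst
    rw [CharP.cast_eq_iff_mod_eq k p, Nat.mod_eq_of_lt (s.2.trans_le hN),
      Nat.mod_eq_of_lt (t.2.trans_le hN)] at hst
    exact Fin.ext hst
  rw [← Module.forall_dual_apply_eq_zero_iff k]
  intro φ
  have := Matrix.eq_zero_of_forall_index_sum_pow_mul_eq_zero hinj
    (v := fun a : Fin N => φ (v a)) fun s => by
      have := congrArg φ (h s)
      rw [map_sum, map_zero, Finset.sum_range] at this
      simpa using this
  exact congrFun this ⟨a, ha⟩

lemma natCast_choose_ne_zero [Fact p.Prime] {d a : ℕ} (hd : d < p) (ha : a ≤ d) :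
    ((d.choose a : ℕ) : k) ≠ 0 := by
  rw [Ne, CharP.cast_eq_zero_iff k p]
  intro h
  have : p ∣ d.factorial := by
    rw [← Nat.choose_mul_factorial_mul_factorial ha, mul_assoc]
    exact h.mul_right _
  exact absurd ((Fact.out : p.Prime).dvd_factorial.1 this) (by omega)

/-- A form of degree less than `p` is determined by its values at the points `(1, y)` with
`y ∈ 𝔽_p`. -/
lemma form_eq_zero {d : ℕ} (hd : d < p) (f : Forms k d)
    (h : ∀ s : ℕ, MvPolynomial.eval ![1, (s : k)] f.1 = 0) : f = 0 := by
  rw [eq_sum_mono k f]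
  refine Finset.sum_eq_zero fun a _ => ?_
  rw [eq_zero_of_sum_natCast_pow_smul_eq_zero k p (N := d + 1) hd (v := fun a =>
    MvPolynomial.coeff (Finsupp.single 0 (d - a) + Finsupp.single 1 (a : ℕ)) f.1) ?_ a.2, zero_smul]
  intro s
  rw [← h s]
  conv_rhs => rw [eq_sum_mono k f]
  rw [Finset.sum_range, Submodule.coe_sum, map_sum]
  refine Finset.sum_congr rfl fun a _ => ?_
  rw [Submodule.coe_smul, MvPolynomial.smul_eval, coe_mono (Nat.lt_succ_iff.1 a.2)]
  simp [mul_comm]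

lemma eval_substHom (g : SL2 p) (f : MvPolynomial (Fin 2) k) (x y : k) :
    MvPolynomial.eval ![x, y] (substHom k p g f) =
      MvPolynomial.eval ![ZMod.castHom (dvd_refl p) k (g 0 0) * x +
        ZMod.castHom (dvd_refl p) k (g 1 0) * y, ZMod.castHom (dvd_refl p) k (g 0 1) * x +
        ZMod.castHom (dvd_refl p) k (g 1 1) * y] f := by
  have : ((MvPolynomial.aeval ![x, y]).comp (substHom k p g)) =
    MvPolynomial.aeval (R := k) ![ZMod.castHom (dvd_refl p) k (g 0 0) * x +
        ZMod.castHom (dvd_refl p) k (g 1 0) * y, ZMod.castHom (dvd_refl p) k (g 0 1) * x +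
        ZMod.castHom (dvd_refl p) k (g 1 1) * y] := by
    refine MvPolynomial.algHom_ext fun j => ?_
    rw [AlgHom.comp_apply, substHom_X]
    fin_cases j <;> simp
  exact DFunLike.congr_fun this f

/-- The matrix `(1, t; 0, 1)`. -/
def upper (t : ZMod p) : SL2 p := ⟨!![1, t; 0, 1], by simp⟩

/-- The matrix `(1, 0; s, 1)`. -/
def lower (s : ZMod p) : SL2 p := ⟨!![1, 0; s, 1], by simp⟩

/-- The matrix `(0, -1; 1, 0)`. -/
def weyl : SL2 p := ⟨!![0, -1; 1, 0], by simp⟩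

/-- The upper unipotents move (1, 0) to all points (1, t), so a fixed form is constant on these
points and differs from a multiple of X^d by a form vanishing on all of them. -/
lemma eq_smul_of_upper_fixed {d : ℕ} (hd : d < p) (f : Forms k d)
    (h : ∀ t, substHom k p (upper p t) f.1 = f.1) :
    f = MvPolynomial.eval ![1, 0] f.1 • mono k d 0 := by
  rw [← sub_eq_zero]
  refine form_eq_zero k p hd _ fun s => ?_
  have h1 : MvPolynomial.eval ![1, (s : k)] f.1 = MvPolynomial.eval ![1, 0] f.1 := by
    conv_rhs => rw [← h s, eval_substHom]
    simp [upper]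
  rw [AddSubgroupClass.coe_sub, map_sub, h1, Submodule.coe_smul, MvPolynomial.smul_eval,
    coe_mono (Nat.zero_le d)]
  simp

/-- Binomial expansion of (X + sY)^d. The free upper limit N lets two different degrees be compared
inside one sum, the extra binomials being zero. -/
lemma homogRep_lower_mono {d N : ℕ} (hN : d < N) (s : ℕ) :
    homogRep k p (d + 1) (lower p s) (mono k d 0) =
      ∑ a ∈ Finset.range N, (s : k) ^ a • ((d.choose a : k) • mono k d a) := by
  refine Subtype.ext ?_
  refine (coe_homogRep k p _ _ _).trans ?_
  rw [coe_mono (Nat.zero_le d), map_mul, map_pow, map_pow, substHom_X, Submodule.coe_sum,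
    ← Finset.sum_subset (Finset.range_subset_range.2 (Nat.succ_le_of_lt hN))]
  · simp only [Fin.sum_univ_two, pow_zero, mul_one, Nat.sub_zero]
    rw [add_comm, add_pow]
    refine Finset.sum_congr rfl fun a ha => ?_
    have ha' : a ≤ d := Nat.lt_succ_iff.1 (Finset.mem_range.1 ha)
    rw [Submodule.coe_smul, Submodule.coe_smul, coe_mono ha']
    simp [lower, MvPolynomial.smul_eq_C_mul, mul_pow]
    ring
  · intro a _ ha
    rw [Finset.mem_range, not_lt] at ha
    rw [Nat.choose_eq_zero_of_lt (by omega)]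
    simp

lemma homogRep_weyl_mono (d : ℕ) :
    homogRep k p (d + 1) (weyl p) (mono k d 0) = mono k d d := by
  refine Subtype.ext ?_
  refine (coe_homogRep k p _ _ _).trans ?_
  rw [coe_mono le_rfl, coe_mono (Nat.zero_le d)]
  rw [map_mul, map_pow, map_pow, substHom_X]
  simp [weyl]

variable {k p}

/-- Highest weight argument: F(X^e) is fixed by the upper unipotents, hence is c X^d. Applying the
lower unipotents and comparing powers of s determines F on each monomial up to binomials, which are
invertible below p. For d ≠ e the larger top exponent forces c = 0; when d < e this uses F(Y^e) = c
Y^d, obtained from the Weyl element. -/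
theorem intertwiningMap_eq_smul [Fact p.Prime] {d e : ℕ} (hd : d < p) (he : e < p)
    (F : (homogRep k p (e + 1)).IntertwiningMap (homogRep k p (d + 1))) :
    ∃ c : k, (d ≠ e → c = 0) ∧ ∀ a ≤ e, F (mono k e a) = c • mono k d a := by
  obtain ⟨c, hc⟩ : ∃ c : k, F (mono k e 0) = c • mono k d 0 := by
    refine ⟨_, eq_smul_of_upper_fixed k p hd _ fun t => ?_⟩
    rw [← coe_homogRep k p (d + 1), ← F.isIntertwining]
    congr 2
    refine Subtype.ext ?_
    refine (coe_homogRep k p _ _ _).trans ?_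
    rw [coe_mono (Nat.zero_le e)]
    rw [map_mul, map_pow, map_pow, substHom_X]
    simp [upper]
  have hY : F (mono k e e) = c • mono k d d := by
    rw [← homogRep_weyl_mono k p, ← homogRep_weyl_mono k p, F.isIntertwining, hc, map_smul]
  let F' : Forms k e →ₗ[k] Forms k d := F.toLinearMap
  have key {a : ℕ} (ha : a < max d e + 1) : (e.choose a : k) • F' (mono k e a) =
      c • (d.choose a : k) • mono k d a := by
    rw [← sub_eq_zero]
    refine eq_zero_of_sum_natCast_pow_smul_eq_zero k p (N := max d e + 1) (by omega)
      (v := fun a => (e.choose a : k) • F' (mono k e a) - c • (d.choose a : k) • mono k d a)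
      (fun s => ?_) ha
    have h1 : F' (homogRep k p (e + 1) (lower p s) (mono k e 0)) =
        homogRep k p (d + 1) (lower p s) (c • mono k d 0) := by
      rw [← hc]
      exact F.isIntertwining _ _ _ _
    rw [map_smul, homogRep_lower_mono k p (N := max d e + 1) (by omega),
      homogRep_lower_mono k p (N := max d e + 1) (by omega), map_sum, Finset.smul_sum,
      ← sub_eq_zero, ← Finset.sum_sub_distrib] at h1
    rw [← h1]
    refine Finset.sum_congr rfl fun a _ => ?_
    rw [map_smul, map_smul, smul_sub, smul_comm c ((s : k) ^ a)]
  have hne (d : ℕ) : mono k d d ≠ 0 := by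
    have := (formsBasis k d).ne_zero (Fin.last d)
    rwa [formsBasis_apply] at this
  have hc0 : d ≠ e → c = 0 := by
    intro hde
    obtain hlt | hlt := hde.lt_or_gt
    · have h1 := key (a := e) (by omega)
      rw [Nat.choose_self, Nat.choose_eq_zero_of_lt hlt, Nat.cast_one, one_smul, Nat.cast_zero,
        zero_smul, smul_zero] at h1
      replace h1 := hY.symm.trans h1
      exact (smul_eq_zero.1 h1).resolve_right (hne d)
    · have h1 := key (a := d) (by omega)
      rw [Nat.choose_self, Nat.choose_eq_zero_of_lt hlt, Nat.cast_one, one_smul, Nat.cast_zero,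
        zero_smul] at h1
      exact (smul_eq_zero.1 h1.symm).resolve_right (hne d)
  refine ⟨c, hc0, fun a ha => ?_⟩
  have h1 := key (a := a) (by omega)
  have h2 := natCast_choose_ne_zero k p he ha
  obtain rfl | hde := eq_or_ne d e
  · rw [smul_comm] at h1
    exact smul_right_injective _ h2 h1
  · rw [hc0 hde, zero_smul] at h1 ⊢
    exact (smul_eq_zero.1 h1).resolve_left h2

theorem exists_eq_smul_id [Fact p.Prime] {n : ℕ} (hn : 1 ≤ n) (hn' : n ≤ p)
    (F : (homogRep k p n).IntertwiningMap (homogRep k p n)) : ∃ c : k, F = c • .id _ := by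
  obtain ⟨d, rfl⟩ := Nat.exists_eq_add_of_le' hn
  obtain ⟨c, -, hc⟩ := intertwiningMap_eq_smul (by omega) (by omega) F
  exact ⟨c, IntertwiningMap.ext (forms_hom_ext k hc)⟩

theorem intertwiningMap_eq_zero [Fact p.Prime] {m n : ℕ} (hm : 1 ≤ m) (hm' : m ≤ p) (hn : 1 ≤ n)
    (hn' : n ≤ p) (h : m ≠ n) (F : (homogRep k p m).IntertwiningMap (homogRep k p n)) : F = 0 := by
  obtain ⟨d, rfl⟩ := Nat.exists_eq_add_of_le' hn
  obtain ⟨e, rfl⟩ := Nat.exists_eq_add_of_le' hm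
  obtain ⟨c, hc0, hc⟩ := intertwiningMap_eq_smul (by omega) (by omega) F
  refine IntertwiningMap.ext (forms_hom_ext k fun a ha => ?_)
  refine (hc a ha).trans ?_
  rw [hc0 (by omega), zero_smul]
  rfl

end SL2Modules

/-! ### The Clebsch-Gordan splitting of V_2 ⊗ V_{d+2} -/

section ClebschGordan

variable {k : Type u} [Field k] {p : ℕ} [CharP k p]

variable (k) in
/-- The entries of a matrix over `𝔽_p` as elements of `k`. -/
def entry (g : SL2 p) (i j : Fin 2) : k := ZMod.castHom (dvd_refl p) k (g i j)

lemma entry_det (g : SL2 p) :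
    entry k g 0 0 * entry k g 1 1 - entry k g 0 1 * entry k g 1 0 = 1 := by
  have := congrArg (ZMod.castHom (dvd_refl p) k) (g.2.symm.trans (Matrix.det_fin_two g.1))
  rw [map_one, map_sub, map_mul, map_mul] at this
  exact this.symm

lemma pderiv_substHom (g : SL2 p) (j : Fin 2) (f : MvPolynomial (Fin 2) k) :
    MvPolynomial.pderiv j (substHom k p g f) =
      ∑ i, entry k g j i • substHom k p g (MvPolynomial.pderiv i f) := by
  induction f using MvPolynomial.induction_on with
  | C a =>
    have : substHom k p g (MvPolynomial.C a) = MvPolynomial.C a :=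
      (substHom k p g).commutes a
    simp [this]
  | add f f' hf hf' => simp only [map_add, hf, hf', smul_add, Finset.sum_add_distrib]
  | mul_X f i hf =>
    simp only [map_mul, Derivation.leibniz, hf, substHom_X, map_add, Fin.sum_univ_two, smul_eq_mul,
      MvPolynomial.smul_eq_C_mul]
    fin_cases i <;> fin_cases j <;> simp [MvPolynomial.pderiv_X, entry] <;> ring

variable (k) in
/-- The variables as linear forms. -/
noncomputable def varForm (j : Fin 2) : Forms k 1 :=
  ⟨MvPolynomial.X j, MvPolynomial.isHomogeneous_X k j⟩

lemma forms_one_hom_ext {E : Type*} [AddCommMonoid E] [Module k E] {F F' : Forms k 1 →ₗ[k] E}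
    (h : ∀ j, F (varForm k j) = F' (varForm k j)) : F = F' := by
  refine forms_hom_ext k fun a ha => ?_
  have : mono k 1 a = varForm k ⟨a, by omega⟩ := by
    refine Subtype.ext ?_
    rw [coe_mono ha]
    interval_cases a <;> simp [varForm]
  rw [this]
  exact h _

variable (k) in
/-- Multiplication of a form by a linear form. -/
noncomputable def mulForm (d : ℕ) : Forms k 1 →ₗ[k] Forms k d →ₗ[k] Forms k (d + 1) :=
  LinearMap.mk₂ k (fun l f => ⟨l.1 * f.1, by
      have := MvPolynomial.IsHomogeneous.mul l.2 f.2
      rwa [add_comm] at this⟩)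
    (fun _ _ _ => Subtype.ext (add_mul _ _ _)) (fun _ _ _ => Subtype.ext (smul_mul_assoc _ _ _))
    (fun _ _ _ => Subtype.ext (mul_add _ _ _)) (fun _ _ _ => Subtype.ext (mul_smul_comm _ _ _))

variable (k) in
/-- Partial derivatives of forms. -/
noncomputable def derivForm (d : ℕ) (j : Fin 2) : Forms k (d + 1) →ₗ[k] Forms k d :=
  (MvPolynomial.pderiv (R := k) j).toLinearMap.restrict fun _ hf =>
    MvPolynomial.IsHomogeneous.pderiv hf

variable (k) in
/-- The Jacobian of a linear form and a form. -/
noncomputable def jacobian (d : ℕ) : Forms k 1 →ₗ[k] Forms k (d + 1) →ₗ[k] Forms k d :=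
  LinearMap.mk₂ k (fun l f => MvPolynomial.coeff 0 (derivForm k 0 0 l).1 • derivForm k d 1 f -
      MvPolynomial.coeff 0 (derivForm k 0 1 l).1 • derivForm k d 0 f)
    (fun _ _ _ => by
      simp only [map_add, Submodule.coe_add, MvPolynomial.coeff_add, add_smul]; abel)
    (fun _ _ _ => by
      simp only [map_smul, Submodule.coe_smul, MvPolynomial.coeff_smul, smul_assoc, smul_sub])
    (fun _ _ _ => by simp only [map_add, smul_add]; abel)
    (fun c _ _ => by simp only [map_smul, smul_sub, smul_comm c])

variable (k) in
/-- The polarisation `f ↦ X ⊗ ∂f/∂X + Y ⊗ ∂f/∂Y`. -/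
noncomputable def polarize (d : ℕ) : Forms k (d + 1) →ₗ[k] Forms k 1 ⊗[k] Forms k d :=
  ∑ j, TensorProduct.mk k _ _ (varForm k j) ∘ₗ derivForm k d j

variable (k) in
/-- The map `f ↦ X ⊗ Y f - Y ⊗ X f`. -/
noncomputable def wedge (d : ℕ) : Forms k d →ₗ[k] Forms k 1 ⊗[k] Forms k (d + 1) :=
  TensorProduct.mk k _ _ (varForm k 0) ∘ₗ mulForm k d (varForm k 1) +
    (-1 : k) • TensorProduct.mk k _ _ (varForm k 1) ∘ₗ mulForm k d (varForm k 0)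

variable (p) in
/-- Substitution on forms. -/
noncomputable def substForm (d : ℕ) (g : SL2 p) : Forms k d →ₗ[k] Forms k d :=
  homogRep k p (d + 1) g

lemma substForm_varForm (g : SL2 p) (i : Fin 2) :
    substForm p 1 g (varForm k i) = ∑ j, entry k g j i • varForm k j := by
  refine Subtype.ext ((substHom_X k p g i).trans ?_)
  simp [varForm, entry, MvPolynomial.smul_eq_C_mul]

lemma substForm_mulForm (g : SL2 p) {d : ℕ} (l : Forms k 1) (f : Forms k d) :
    substForm p (d + 1) g (mulForm k d l f) =
      mulForm k d (substForm p 1 g l) (substForm p d g f) :=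
  Subtype.ext (map_mul (substHom k p g) l.1 f.1)

lemma derivForm_substForm (g : SL2 p) {d : ℕ} (j : Fin 2) (f : Forms k (d + 1)) :
    derivForm k d j (substForm p (d + 1) g f) =
      ∑ i, entry k g j i • substForm p d g (derivForm k d i f) := by
  refine Subtype.ext ((pderiv_substHom g j f.1).trans ?_)
  rw [Submodule.coe_sum]
  rfl

lemma polarize_apply {d : ℕ} (f : Forms k (d + 1)) :
    polarize k d f = varForm k 0 ⊗ₜ derivForm k d 0 f + varForm k 1 ⊗ₜ derivForm k d 1 f := by
  simp [polarize, Fin.sum_univ_two]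

lemma wedge_apply {d : ℕ} (f : Forms k d) :
    wedge k d f = varForm k 0 ⊗ₜ mulForm k d (varForm k 1) f +
      (-1 : k) • varForm k 1 ⊗ₜ mulForm k d (varForm k 0) f := by
  simp [wedge]

lemma polarize_substForm (g : SL2 p) {d : ℕ} (f : Forms k (d + 1)) :
    polarize k d (substForm p (d + 1) g f) =
      TensorProduct.map (substForm p 1 g) (substForm p d g) (polarize k d f) := by
  simp only [polarize_apply, derivForm_substForm, Fin.sum_univ_two, map_add,
    TensorProduct.map_tmul, substForm_varForm, TensorProduct.tmul_add, TensorProduct.add_tmul,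
    ← TensorProduct.smul_tmul', TensorProduct.tmul_smul]
  module

lemma wedge_substForm (g : SL2 p) {d : ℕ} (f : Forms k d) :
    wedge k d (substForm p d g f) =
      TensorProduct.map (substForm p 1 g) (substForm p (d + 1) g) (wedge k d f) := by
  -- X ⊗ Y - Y ⊗ X is scaled by the determinant; inserting 1 as the determinant turns the claim into
  -- a formal identity in the matrix entries.
  rw [← one_smul k (wedge k d (substForm p d g f)), ← entry_det (k := k) g]
  simp only [wedge_apply, TensorProduct.map_tmul, substForm_mulForm, substForm_varForm,
    Fin.sum_univ_two, map_add, map_smul, LinearMap.add_apply, LinearMap.smul_apply,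
    TensorProduct.tmul_add, TensorProduct.add_tmul, ← TensorProduct.smul_tmul',
    TensorProduct.tmul_smul]
  module

lemma coeff_derivForm (j i : Fin 2) :
    MvPolynomial.coeff 0 (derivForm k 0 j (varForm k i)).1 = if i = j then 1 else 0 := by
  change MvPolynomial.coeff 0 (MvPolynomial.pderiv j (MvPolynomial.X i)) = _
  rw [MvPolynomial.pderiv_X, Pi.single_apply]
  split_ifs <;> simp

lemma jacobian_varForm_zero {d : ℕ} (f : Forms k (d + 1)) :
    jacobian k d (varForm k 0) f = derivForm k d 1 f := by
  rw [jacobian, LinearMap.mk₂_apply, coeff_derivForm, coeff_derivForm]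
  simp

lemma jacobian_varForm_one {d : ℕ} (f : Forms k (d + 1)) :
    jacobian k d (varForm k 1) f = -derivForm k d 0 f := by
  rw [jacobian, LinearMap.mk₂_apply, coeff_derivForm, coeff_derivForm]
  simp

lemma jacobian_substForm (g : SL2 p) {d : ℕ} (l : Forms k 1) (f : Forms k (d + 1)) :
    jacobian k d (substForm p 1 g l) (substForm p (d + 1) g f) =
      substForm p d g (jacobian k d l f) := by
  suffices h : (jacobian k d).flip (substForm p (d + 1) g f) ∘ₗ substForm p 1 g =
      substForm p d g ∘ₗ (jacobian k d).flip f from LinearMap.congr_fun h l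
  refine forms_one_hom_ext fun j => ?_
  change jacobian k d (substForm p 1 g (varForm k j)) (substForm p (d + 1) g f) =
    substForm p d g (jacobian k d (varForm k j) f)
  have h := entry_det (k := k) g
  fin_cases j
  · rw [← one_smul k (substForm p d g _), ← h]
    simp only [substForm_varForm, Fin.sum_univ_two, map_add, map_smul, LinearMap.add_apply,
      LinearMap.smul_apply, jacobian_varForm_zero, jacobian_varForm_one, derivForm_substForm,
      Fin.zero_eta]
    module
  · rw [← one_smul k (substForm p d g _), ← h]
    simp only [substForm_varForm, Fin.sum_univ_two, map_add, map_smul, LinearMap.add_apply,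
      LinearMap.smul_apply, jacobian_varForm_zero, jacobian_varForm_one, derivForm_substForm,
      Fin.mk_one, map_neg]
    module

lemma sum_mulForm_derivForm {d : ℕ} (f : Forms k (d + 1)) :
    mulForm k d (varForm k 0) (derivForm k d 0 f) + mulForm k d (varForm k 1) (derivForm k d 1 f) =
      ((d + 1 : ℕ) : k) • f := by
  refine Subtype.ext ?_
  have := MvPolynomial.IsHomogeneous.sum_X_mul_pderiv f.2
  rw [Fin.sum_univ_two] at this
  refine this.trans ?_
  rw [Submodule.coe_smul, Nat.cast_smul_eq_nsmul]

lemma derivForm_comm {d : ℕ} (f : Forms k (d + 2)) :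
    derivForm k d 0 (derivForm k (d + 1) 1 f) = derivForm k d 1 (derivForm k (d + 1) 0 f) := by
  refine Subtype.ext ?_
  change MvPolynomial.pderiv 0 (MvPolynomial.pderiv 1 f.1) =
    MvPolynomial.pderiv 1 (MvPolynomial.pderiv 0 f.1)
  ext m
  simp only [MvPolynomial.coeff_pderiv]
  simp [add_right_comm]
  ring

lemma coe_derivForm {d : ℕ} (i : Fin 2) (f : Forms k (d + 1)) :
    (derivForm k d i f : MvPolynomial (Fin 2) k) = MvPolynomial.pderiv i f.1 := rfl

lemma coe_mulForm {d : ℕ} (l : Forms k 1) (f : Forms k d) :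
    (mulForm k d l f : MvPolynomial (Fin 2) k) = l.1 * f.1 := rfl

lemma pderiv_X_mul (i j : Fin 2) (f : MvPolynomial (Fin 2) k) :
    MvPolynomial.pderiv i (MvPolynomial.X j * f) =
      (if j = i then f else 0) + MvPolynomial.X j * MvPolynomial.pderiv i f := by
  rw [MvPolynomial.pderiv_mul, MvPolynomial.pderiv_X, Pi.single_apply]
  split_ifs <;> simp

lemma derivForm_mulForm {d : ℕ} (i j : Fin 2) (f : Forms k (d + 1)) :
    derivForm k (d + 1) i (mulForm k (d + 1) (varForm k j) f) =
      (if j = i then f else 0) + mulForm k d (varForm k j) (derivForm k d i f) := by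
  refine Subtype.ext ?_
  rw [coe_derivForm, coe_mulForm, Submodule.coe_add, coe_mulForm, coe_derivForm]
  refine (pderiv_X_mul i j f.1).trans ?_
  split_ifs <;> rfl

lemma exists_algebraMap_eq {k : Type u} [Field k] (f : Forms k 0) :
    ∃ c : k, algebraMap k (MvPolynomial (Fin 2) k) c = f.1 := by
  have h : f.1 ∈ MvPolynomial.homogeneousSubmodule (Fin 2) k 0 := f.2
  rw [MvPolynomial.homogeneousSubmodule_zero] at h
  exact Submodule.mem_one.1 h

lemma derivForm_mulForm_zero (i j : Fin 2) (f : Forms k 0) :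
    derivForm k 0 i (mulForm k 0 (varForm k j) f) = if j = i then f else 0 := by
  have hf : MvPolynomial.pderiv i f.1 = 0 := by
    obtain ⟨c, hc⟩ := exists_algebraMap_eq f
    rw [← hc]
    exact MvPolynomial.pderiv_C
  refine Subtype.ext ?_
  rw [coe_derivForm, coe_mulForm]
  refine (pderiv_X_mul i j f.1).trans ?_
  rw [hf, mul_zero, add_zero]
  split_ifs <;> rfl

section Intertwining

variable (k p)

/-- The multiplication map `V_2 ⊗ V_{d+1} → V_{d+2}`. -/
noncomputable def mulInt (d : ℕ) :
    ((homogRep k p 2).tprod (homogRep k p (d + 1))).IntertwiningMap (homogRep k p (d + 2)) where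
  toLinearMap := TensorProduct.lift (mulForm k d)
  isIntertwining' g := TensorProduct.ext' fun l f => (substForm_mulForm g l f).symm

/-- The polarisation `V_{d+2} → V_2 ⊗ V_{d+1}`. -/
noncomputable def polarizeInt (d : ℕ) :
    (homogRep k p (d + 2)).IntertwiningMap ((homogRep k p 2).tprod (homogRep k p (d + 1))) where
  toLinearMap := polarize k d
  isIntertwining' g := LinearMap.ext fun f => polarize_substForm g f

/-- The Jacobian `V_2 ⊗ V_{d+2} → V_{d+1}`. -/
noncomputable def jacobianInt (d : ℕ) :
    ((homogRep k p 2).tprod (homogRep k p (d + 2))).IntertwiningMap (homogRep k p (d + 1)) where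
  toLinearMap := TensorProduct.lift (jacobian k d)
  isIntertwining' g := TensorProduct.ext' fun l f => jacobian_substForm g l f

/-- The embedding `V_{d+1} → V_2 ⊗ V_{d+2}`. -/
noncomputable def wedgeInt (d : ℕ) :
    (homogRep k p (d + 1)).IntertwiningMap ((homogRep k p 2).tprod (homogRep k p (d + 2))) where
  toLinearMap := wedge k d
  isIntertwining' g := LinearMap.ext fun f => wedge_substForm g f

end Intertwining

lemma mulForm_polarize {d : ℕ} (f : Forms k (d + 1)) :
    TensorProduct.lift (mulForm k d) (polarize k d f) = ((d + 1 : ℕ) : k) • f := by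
  rw [polarize_apply, map_add, TensorProduct.lift.tmul, TensorProduct.lift.tmul,
    sum_mulForm_derivForm]

lemma mulForm_comm {d : ℕ} (i j : Fin 2) (f : Forms k d) :
    mulForm k (d + 1) (varForm k i) (mulForm k d (varForm k j) f) =
      mulForm k (d + 1) (varForm k j) (mulForm k d (varForm k i) f) := by
  refine Subtype.ext ?_
  simp only [coe_mulForm]
  ring

lemma mulForm_wedge {d : ℕ} (f : Forms k d) :
    TensorProduct.lift (mulForm k (d + 1)) (wedge k d f) = 0 := by
  rw [wedge_apply, map_add, map_smul, TensorProduct.lift.tmul, TensorProduct.lift.tmul,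
    mulForm_comm]
  module

lemma jacobian_polarize {d : ℕ} (f : Forms k (d + 2)) :
    TensorProduct.lift (jacobian k d) (polarize k (d + 1) f) = 0 := by
  rw [polarize_apply, map_add, TensorProduct.lift.tmul, TensorProduct.lift.tmul,
    jacobian_varForm_zero, jacobian_varForm_one, derivForm_comm]
  module

lemma jacobian_wedge {d : ℕ} (f : Forms k (d + 1)) :
    TensorProduct.lift (jacobian k (d + 1)) (wedge k (d + 1) f) = ((d + 3 : ℕ) : k) • f := by
  rw [wedge_apply, map_add, map_smul, TensorProduct.lift.tmul, TensorProduct.lift.tmul,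
    jacobian_varForm_zero, jacobian_varForm_one, derivForm_mulForm, derivForm_mulForm]
  have h := sum_mulForm_derivForm f
  have h2 : ((d + 3 : ℕ) : k) • f = (2 : k) • f + ((d + 1 : ℕ) : k) • f := by
    rw [← add_smul]
    congr 1
    push_cast
    ring
  rw [h2, ← h, if_pos rfl, if_pos rfl]
  module

lemma jacobian_wedge_zero (f : Forms k 0) :
    TensorProduct.lift (jacobian k 0) (wedge k 0 f) = (2 : k) • f := by
  rw [wedge_apply, map_add, map_smul, TensorProduct.lift.tmul, TensorProduct.lift.tmul,
    jacobian_varForm_zero, jacobian_varForm_one, derivForm_mulForm_zero, derivForm_mulForm_zero,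
    if_pos rfl, if_pos rfl]
  module

/-- For l a variable, the Leibniz rule makes the cross terms cancel, and Euler's identity collects
the rest. Only d + 2 has to be inverted for the splitting, so it holds right up to the summand V_p.
-/
lemma polarize_mulForm_add_wedge_jacobian {d : ℕ} (l : Forms k 1) (f : Forms k (d + 1)) :
    polarize k (d + 1) (mulForm k (d + 1) l f) + wedge k d (jacobian k d l f) =
      ((d + 2 : ℕ) : k) • l ⊗ₜ f := by
  suffices h : polarize k (d + 1) ∘ₗ (mulForm k (d + 1)).flip f +
      wedge k d ∘ₗ (jacobian k d).flip f =
      ((d + 2 : ℕ) : k) • (TensorProduct.mk k (Forms k 1) (Forms k (d + 1))).flip f from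
    LinearMap.congr_fun h l
  refine forms_one_hom_ext fun j => ?_
  change polarize k (d + 1) (mulForm k (d + 1) (varForm k j) f) +
    wedge k d (jacobian k d (varForm k j) f) = ((d + 2 : ℕ) : k) • varForm k j ⊗ₜ f
  have h := sum_mulForm_derivForm f
  have h2 : ((d + 2 : ℕ) : k) • varForm k j ⊗ₜ[k] f =
      varForm k j ⊗ₜ[k] f + varForm k j ⊗ₜ[k] (((d + 1 : ℕ) : k) • f) := by
    rw [TensorProduct.tmul_smul]
    push_cast
    module
  rw [h2, ← h]
  fin_cases j
  · simp only [Fin.zero_eta, jacobian_varForm_zero, polarize_apply, wedge_apply, derivForm_mulForm,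
      if_pos, TensorProduct.tmul_add, zero_ne_one, if_false, zero_add]
    module
  · simp only [Fin.mk_one, jacobian_varForm_one, polarize_apply, wedge_apply, derivForm_mulForm,
      if_pos, TensorProduct.tmul_add, one_ne_zero, if_false, zero_add, map_neg]
    module

variable (k) in
/-- `V_2 ⊗ V_{d+2} ≅ V_{d+3} ⊕ V_{d+1}` as long as `d + 2` is invertible. -/
theorem isBiproduct_tprod_two (d : ℕ) (hd : ((d + 2 : ℕ) : k) ≠ 0) :
    IsBiproduct ((homogRep k p 2).tprod (homogRep k p (d + 2))) (homogRep k p (d + 3))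
      (homogRep k p (d + 1)) := by
  refine ⟨polarizeInt k p (d + 1), ((d + 2 : ℕ) : k)⁻¹ • mulInt k p (d + 1), wedgeInt k p d,
    ((d + 2 : ℕ) : k)⁻¹ • jacobianInt k p d, ?_, ?_, ?_, ?_, ?_⟩
  · refine IntertwiningMap.ext (LinearMap.ext fun f => ?_)
    refine (congrArg (((d + 2 : ℕ) : k)⁻¹ • ·) (mulForm_polarize f)).trans ?_
    exact inv_smul_smul₀ hd _
  · refine IntertwiningMap.ext (LinearMap.ext fun f => ?_)
    have h : TensorProduct.lift (jacobian k d) (wedge k d f) = ((d + 2 : ℕ) : k) • f := by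
      -- Constants are treated apart because `derivForm` is defined only on forms of positive
      -- degree.
      cases d with
      | zero => exact_mod_cast jacobian_wedge_zero f
      | succ d => exact jacobian_wedge f
    refine (congrArg (((d + 2 : ℕ) : k)⁻¹ • ·) h).trans ?_
    exact inv_smul_smul₀ hd _
  · refine IntertwiningMap.ext (LinearMap.ext fun f => ?_)
    refine (congrArg (((d + 2 : ℕ) : k)⁻¹ • ·) (mulForm_wedge f)).trans ?_
    exact smul_zero _
  · refine IntertwiningMap.ext (LinearMap.ext fun f => ?_)
    refine (congrArg (((d + 2 : ℕ) : k)⁻¹ • ·) (jacobian_polarize f)).trans ?_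
    exact smul_zero _
  · refine IntertwiningMap.ext (TensorProduct.ext' fun l f => ?_)
    change polarize k (d + 1) (((d + 2 : ℕ) : k)⁻¹ • mulForm k (d + 1) l f) +
      wedge k d (((d + 2 : ℕ) : k)⁻¹ • jacobian k d l f) = l ⊗ₜ f
    rw [map_smul, map_smul, ← smul_add, polarize_mulForm_add_wedge_jacobian, inv_smul_smul₀ hd]

end ClebschGordan

/-! ### Scalar endomorphisms imply indecomposability -/

section Indecomposable

variable {k G X : Type*} [Field k] [Monoid G] [AddCommGroup X] [Module k X]
  {ρ : Representation k G X}

/-- The projection along a complement is an endomorphism, hence a scalar: the scalar 0 kills one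
summand and a nonzero scalar kills the other. -/
lemma isIndecomposable_of_forall_eq_smul [Nontrivial X]
    (h : ∀ f : ρ.IntertwiningMap ρ, ∃ c : k, f = c • .id ρ) : IsIndecomposable ρ := by
  refine ⟨inferInstance, fun W₁ W₂ hW => ?_⟩
  have hc : IsCompl W₁.toSubmodule W₂.toSubmodule :=
    ⟨disjoint_iff.2 (congrArg Subrepresentation.toSubmodule (disjoint_iff.1 hW.1)),
      codisjoint_iff.2 (congrArg Subrepresentation.toSubmodule (codisjoint_iff.1 hW.2))⟩
  let P := W₁.toSubmodule.projection W₂.toSubmodule hc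
  have h1 {v : X} (hv : v ∈ W₁.toSubmodule) : P v = v :=
    Submodule.projection_apply_of_mem_left hc hv
  have h2 {v : X} (hv : v ∈ W₂.toSubmodule) : P v = 0 :=
    (Submodule.projection_apply_eq_zero_iff hc).2 hv
  obtain ⟨c, hc'⟩ := h (LinearMap.intertwiningMap_of_isIntertwiningMap ρ ρ P
    fun g v => by
      obtain ⟨a, ha, b, hb, rfl⟩ := Submodule.mem_sup.1
        (hc.sup_eq_top ▸ Submodule.mem_top : v ∈ W₁.toSubmodule ⊔ W₂.toSubmodule)
      simp only [map_add]
      rw [h1 ha, h2 hb, h1 (W₁.apply_mem_toSubmodule g ha), h2 (W₂.apply_mem_toSubmodule g hb),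
        map_zero])
  have hsm (v : X) : P v = c • v := DFunLike.congr_fun hc' v
  obtain rfl | hc0 := eq_or_ne c 0
  · left
    refine Subrepresentation.toSubmodule_injective ((Submodule.eq_bot_iff _).2 fun v hv => ?_)
    rw [← h1 hv, hsm, zero_smul]
  · right
    refine Subrepresentation.toSubmodule_injective ((Submodule.eq_bot_iff _).2 fun v hv => ?_)
    exact (smul_eq_zero.1 ((hsm v).symm.trans (h2 hv))).resolve_left hc0

end Indecomposable

/-! ### Non-projectivity below p and the Steinberg module -/

section Projectivity

variable {k : Type u} [Field k] {p : ℕ} [CharP k p] [Fact p.Prime]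

lemma upper_add (s t : ZMod p) : upper p (s + t) = upper p s * upper p t := by
  refine Subtype.ext ?_
  rw [Matrix.SpecialLinearGroup.coe_mul]
  simp [upper, add_comm]

lemma natCast_card_SL2_eq_zero : ((Nat.card (SL2 p) : ℕ) : k) = 0 := by
  rw [CharP.cast_eq_zero_iff k p]
  let f : Multiplicative (ZMod p) →* SL2 p :=
    { toFun := fun t => upper p t.toAdd
      map_one' := by
        refine Subtype.ext ?_
        simp [upper, Matrix.one_fin_two]
      map_mul' := fun s t => upper_add s.toAdd t.toAdd }
  have hf : Function.Injective f := fun s t h => by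
    have := congrArg (fun g : SL2 p => g 0 1) h
    exact this
  have := Subgroup.card_dvd_of_injective f hf
  rwa [Nat.card_eq_fintype_card (α := Multiplicative (ZMod p)), Fintype.card_multiplicative,
    ZMod.card] at this

/-- The trace of a relative trace is a multiple of |G|, which is 0 in k, while the identity has
trace n, nonzero in k. -/
lemma not_isProjective_homogRep {n : ℕ} (hn : 1 ≤ n) (hn' : n < p) :
    ¬ IsProjective (homogRep k p n) := by
  intro h
  obtain ⟨φ, hφ⟩ := (isProjective_iff (homogRep k p n)).1 h
  have h1 := trace_transfer (ρ := homogRep k p n) φ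
  rw [hφ, natCast_card_SL2_eq_zero, zero_mul] at h1
  have h2 : LinearMap.trace k _ (IntertwiningMap.id (homogRep k p n)).toLinearMap =
    (Module.finrank k (Forms k (n - 1)) : k) := LinearMap.trace_id k _
  rw [h2, finrank_forms, CharP.cast_eq_zero_iff k p] at h1
  have := Nat.le_of_dvd (by omega) h1
  omega

lemma isIndecomposable_homogRep {n : ℕ} (hn : 1 ≤ n) (hn' : n ≤ p) :
    IsIndecomposable (homogRep k p n) := by
  have : Nontrivial (Forms k (n - 1)) :=
    Module.nontrivial_of_finrank_pos (R := k) (by rw [finrank_forms]; omega)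
  exact isIndecomposable_of_forall_eq_smul fun F => exists_eq_smul_id hn hn' F

/-- The matrices in `SL₂(𝔽_p)` with nonzero upper left entry. -/
def bigCellEquiv : {g : SL2 p // g 0 0 ≠ 0} ≃ {a : ZMod p // a ≠ 0} × ZMod p × ZMod p where
  toFun g := (⟨g.1 0 0, g.2⟩, g.1 0 1, g.1 1 0)
  invFun x := ⟨⟨!![x.1.1, x.2.1; x.2.2, x.1.1⁻¹ * (1 + x.2.1 * x.2.2)], by
    rw [Matrix.det_fin_two_of, mul_inv_cancel_left₀ x.1.2, add_sub_cancel_right]⟩, x.1.2⟩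
  left_inv g := by
    refine Subtype.ext (Subtype.ext ?_)
    have hdet := Matrix.det_fin_two g.1.1
    rw [g.1.2] at hdet
    have hg : g.1.1 0 0 ≠ 0 := g.2
    have h : (g.1.1 0 0)⁻¹ * (1 + g.1.1 0 1 * g.1.1 1 0) = g.1.1 1 1 := by
      rw [inv_mul_eq_iff_eq_mul₀ hg]
      linear_combination hdet
    ext i j
    fin_cases i <;> fin_cases j
    · rfl
    · rfl
    · rfl
    · exact h
  right_inv x := rfl

lemma sum_pow_sub_one : ∑ x : ZMod p, x ^ (p - 1) = -1 := by
  have hp : p - 1 ≠ 0 := by have := (Fact.out : p.Prime).two_le; omega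
  have h (x : ZMod p) : x ^ (p - 1) = 1 - if x = 0 then 1 else 0 := by
    split_ifs with hx
    · rw [hx, zero_pow hp, sub_self]
    · rw [ZMod.pow_card_sub_one_eq_one hx, sub_zero]
  simp [h, ZMod.card]

/-- Only matrices with a ≠ 0 contribute, and there ad = 1 + bc. The choice of a gives p - 1 = -1.
The sum over b, c is 1: b = 0 contributes p = 0, and each of the p - 1 values b ≠ 0 contributes -1.
-/
lemma sum_SL2_diag_pow : ∑ g : SL2 p, (g 0 0 * g 1 1) ^ (p - 1) = -1 := by
  have hp : p - 1 ≠ 0 := by have := (Fact.out : p.Prime).two_le; omega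
  have h1 : ∑ g : SL2 p, (g 0 0 * g 1 1) ^ (p - 1) =
      ∑ g : {g : SL2 p // g 0 0 ≠ 0}, (g.1 0 0 * g.1 1 1) ^ (p - 1) := by
    rw [← Finset.sum_subtype (Finset.univ.filter fun g : SL2 p => g 0 0 ≠ 0) (by simp)
      fun g => (g 0 0 * g 1 1) ^ (p - 1)]
    refine (Finset.sum_subset (Finset.subset_univ _) fun g _ hg => ?_).symm
    simp only [Finset.mem_filter, Finset.mem_univ, true_and, not_not] at hg
    rw [hg, zero_mul, zero_pow hp]
  have h2 : ∑ g : {g : SL2 p // g 0 0 ≠ 0}, (g.1 0 0 * g.1 1 1) ^ (p - 1) =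
      ∑ x : {a : ZMod p // a ≠ 0} × ZMod p × ZMod p, (1 + x.2.1 * x.2.2) ^ (p - 1) := by
    rw [← bigCellEquiv.symm.sum_comp]
    refine Finset.sum_congr rfl fun x _ => congrArg (· ^ (p - 1)) ?_
    exact mul_inv_cancel_left₀ x.1.2 _
  have h3 (b : ZMod p) : ∑ c : ZMod p, (1 + b * c) ^ (p - 1) = if b = 0 then 0 else -1 := by
    split_ifs with hb
    · simp [hb]
    · rw [← sum_pow_sub_one]
      exact Fintype.sum_bijective (fun c => 1 + b * c)
        ((Equiv.addLeft 1).bijective.comp (mulLeft_bijective₀ b hb)) _ _ fun _ => rfl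
  have h4 : ∑ b : ZMod p, (if b = 0 then (0 : ZMod p) else -1) = 1 := by
    have h (b : ZMod p) : (if b = 0 then (0 : ZMod p) else -1) = -b ^ (p - 1) := by
      split_ifs with hb
      · rw [hb, zero_pow hp, neg_zero]
      · rw [ZMod.pow_card_sub_one_eq_one hb]
    simp only [h]
    rw [Finset.sum_neg_distrib, sum_pow_sub_one, neg_neg]
  rw [h1, h2, Fintype.sum_prod_type]
  simp only [Fintype.sum_prod_type, h3, h4]
  simp [Fintype.card_subtype_compl, ZMod.card, Nat.cast_sub (Fact.out : p.Prime).one_le]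

/-- The Steinberg module `V_p` is projective. -/
lemma exists_transfer_eq_id :
    ∃ φ : Forms k (p - 1) →ₗ[k] Forms k (p - 1),
      transfer (homogRep k p p) (homogRep k p p) φ = .id _ := by
  have hp := (Fact.out : p.Prime).one_le
  -- The rank-one map f ↦ f(1, 0) X^(p-1). By Schur its relative trace is a scalar, found by
  -- evaluating the image of X^(p-1) at (1, 0); it is the sum of (ad)^(p-1) over G, that is -1.
  let φ : Forms k (p - 1) →ₗ[k] Forms k (p - 1) :=
    LinearMap.smulRight ((MvPolynomial.aeval (R := k) ![(1 : k), 0]).toLinearMap ∘ₗ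
      (Forms k (p - 1)).subtype) (mono k (p - 1) 0)
  obtain ⟨c, hc⟩ := exists_eq_smul_id hp le_rfl (transfer (homogRep k p p) (homogRep k p p) φ)
  have hφ (f : Forms k (p - 1)) :
      φ f = MvPolynomial.eval ![1, 0] f.1 • mono k (p - 1) 0 := rfl
  have heval (g : SL2 p) : MvPolynomial.eval ![1, 0] (homogRep k p p g (mono k (p - 1) 0)).1 =
      entry k g 0 0 ^ (p - 1) := by
    rw [coe_homogRep, eval_substHom, coe_mono (Nat.zero_le _)]
    simp [entry]
  have hcv : c = -1 := by
    have h1 := transfer_apply (homogRep k p p) (homogRep k p p) φ (mono k (p - 1) 0)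
    rw [hc] at h1
    have h2 := congrArg (fun f : Forms k (p - 1) => MvPolynomial.eval ![(1 : k), 0] f.1) h1
    have h3 (g : SL2 p) : MvPolynomial.eval ![(1 : k), 0]
        (homogRep k p p g (φ (homogRep k p p g⁻¹ (mono k (p - 1) 0)))).1 =
        ZMod.castHom (dvd_refl p) k ((g 0 0 * g 1 1) ^ (p - 1)) := by
      rw [hφ, map_smul, Submodule.coe_smul, MvPolynomial.smul_eval, heval, heval, entry, entry,
        ← map_pow, ← map_pow, ← map_mul, ← mul_pow, Matrix.SpecialLinearGroup.SL2_inv_expl]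
      simp [mul_comm]
    simp only [Submodule.coe_sum, map_sum, h3] at h2
    rw [← map_sum, sum_SL2_diag_pow, map_neg, map_one] at h2
    rw [← h2]
    change c = MvPolynomial.eval ![(1 : k), 0] (c • mono k (p - 1) 0 : Forms k (p - 1)).1
    rw [Submodule.coe_smul, MvPolynomial.smul_eval, coe_mono (Nat.zero_le _)]
    simp
  refine ⟨(-1 : k) • φ, ?_⟩
  rw [map_smul, hc, hcv, smul_smul, neg_mul_neg, one_mul, one_smul]

end Projectivity

/-! ### Equivalences of tensor products -/

section Equivalences

variable {k G : Type*} [Field k] [Monoid G]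
variable {X Y Z : Type*} [AddCommMonoid X] [Module k X] [AddCommMonoid Y] [Module k Y]
  [AddCommMonoid Z] [Module k Z]
variable {ρ : Representation k G X} {σ : Representation k G Y} {τ : Representation k G Z}

/-- Tensoring an equivalence with a representation on the right. -/
noncomputable def equivRTensor (e : σ.Equiv τ) (ρ : Representation k G X) :
    (σ.tprod ρ).Equiv (τ.tprod ρ) :=
  .mk (_root_.TensorProduct.congr e.toLinearEquiv (LinearEquiv.refl k X)) fun g =>
    TensorProduct.ext' fun y x =>
      congrArg (· ⊗ₜ[k] ρ g x) (e.toIntertwiningMap.isIntertwining _ _ g y)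

/-- Tensoring an equivalence with a representation on the left. -/
noncomputable def equivLTensor (e : σ.Equiv τ) (ρ : Representation k G X) :
    (ρ.tprod σ).Equiv (ρ.tprod τ) :=
  .mk (_root_.TensorProduct.congr (LinearEquiv.refl k X) e.toLinearEquiv) fun g =>
    TensorProduct.ext' fun x y =>
      congrArg (ρ g x ⊗ₜ[k] ·) (e.toIntertwiningMap.isIntertwining _ _ g y)

variable (ρ σ τ) in
/-- Exchanging the first two factors of a triple tensor product. -/
noncomputable def equivLeftComm :
    (ρ.tprod (σ.tprod τ)).Equiv (σ.tprod (ρ.tprod τ)) :=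
  .mk (_root_.TensorProduct.leftComm k X Y Z) fun g => by ext; simp

end Equivalences

/-- The fusion coefficients of the non-projective simple modules `V_1, …, V_{p-1}`. -/
def fusion (p i n j : ℕ) : ℕ :=
  if (i + n + j) % 2 = 1 ∧ i < n + j ∧ n < i + j ∧ j < i + n ∧ i + n + j < 2 * p then 1 else 0

/-- Numerical counterpart of expanding V_2 ⊗ V_i ⊗ V_{n+1} through either factor. Indices 0 and p
may occur, and there the coefficient is 0. -/
lemma fusion_add (p i n j : ℕ) (hi : 1 ≤ i) (hi' : i < p) (hj : 1 ≤ j) (hj' : j < p)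
    (hn : n + 2 < p) :
    fusion p i (n + 2) j + fusion p i n j = fusion p (i + 1) (n + 1) j +
      fusion p (i - 1) (n + 1) j := by
  unfold fusion
  split_ifs <;> omega

/-! ### Fusion rules from the Clebsch-Gordan recursion -/

section Family

variable {k : Type*} {G : Type*} [Field k] [Group G] [Fintype G]
variable {W : ℕ → Type*} [∀ n, AddCommGroup (W n)] [∀ n, Module k (W n)]

/-- The structure of the modules `V_1, …, V_p` of `SL₂(𝔽_p)` that determines the multiplicities in
their tensor products. -/
structure IsFusionFamily (p : ℕ) (S : ∀ n, Representation k G (W n)) : Prop where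
  two_lt : 2 < p
  exists_eq_smul : ∀ n, 1 ≤ n → n < p → ∀ f : (S n).IntertwiningMap (S n), ∃ c : k, f = c • .id _
  eq_zero : ∀ m n, 1 ≤ m → m < p → 1 ≤ n → n < p → m ≠ n →
    ∀ f : (S m).IntertwiningMap (S n), f = 0
  not_projective : ∀ n, 1 ≤ n → n < p → ¬ IsProjective (S n)
  projective : ∃ φ, transfer (S p) (S p) φ = .id _
  tprod_one : ∀ n, Nonempty (((S n).tprod (S 1)).Equiv (S n))
  tprod_two : ∀ d, d + 2 < p → IsBiproduct ((S 2).tprod (S (d + 2))) (S (d + 3)) (S (d + 1))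

namespace IsFusionFamily

variable {p : ℕ} {S : ∀ n, Representation k G (W n)} (hS : IsFusionFamily p S)
include hS

lemma stableRank_self {n : ℕ} (hn : 1 ≤ n) (hn' : n < p) : stableRank (S n) (S n) = 1 := by
  refine finrank_eq_one (Submodule.Quotient.mk (.id (S n)) : StableHom (S n) (S n)) ?_ fun x => ?_
  · intro h
    obtain ⟨φ, hφ⟩ := (Submodule.Quotient.mk_eq_zero _).1 h
    exact hS.not_projective n hn hn' ((isProjective_iff _).2 ⟨φ, hφ⟩)
  · induction x using Submodule.Quotient.induction_on with | H f
    obtain ⟨c, rfl⟩ := hS.exists_eq_smul n hn hn' f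
    exact ⟨c, rfl⟩

lemma stableRank_of_ne {m n : ℕ} (hm : 1 ≤ m) (hm' : m < p) (hn : 1 ≤ n) (hn' : n < p)
    (h : m ≠ n) : stableRank (S m) (S n) = 0 := by
  have : Subsingleton (StableHom (S m) (S n)) := by
    refine Submodule.Quotient.subsingleton_iff.2 (eq_top_iff.2 fun f _ => ?_)
    rw [hS.eq_zero m n hm hm' hn hn' h f]
    exact zero_mem _
  exact Module.finrank_zero_of_subsingleton

lemma stableRank_top_tprod (n j : ℕ) : stableRank (S j) ((S p).tprod (S n)) = 0 := by
  obtain ⟨φ, hφ⟩ := hS.projective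
  refine stableRank_eq_zero (φ := φ.rTensor (W n)) ?_ _
  rw [← rTensor_transfer, hφ, IntertwiningMap.rTensor_id]

lemma stableRank_tprod_two_left [∀ n, Module.Finite k (W n)] {i n j : ℕ} (hi : i + 2 < p) :
    stableRank (S j) (((S 2).tprod (S (i + 2))).tprod (S n)) =
      stableRank (S j) ((S (i + 3)).tprod (S n)) + stableRank (S j) ((S (i + 1)).tprod (S n)) :=
  ((hS.tprod_two i hi).rTensor (S n)).stableRank_eq (S j)

lemma stableRank_tprod_two_one_left {n j : ℕ} :
    stableRank (S j) (((S 2).tprod (S 1)).tprod (S n)) =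
      stableRank (S j) ((S 2).tprod (S n)) := by
  obtain ⟨e⟩ := hS.tprod_one 2
  exact stableRank_congr (equivRTensor e (S n)) _

lemma stableRank_tprod_two_right [∀ n, Module.Finite k (W n)] {i n j : ℕ} (hn : n + 2 < p) :
    stableRank (S j) (((S 2).tprod (S i)).tprod (S (n + 2))) =
      stableRank (S j) ((S i).tprod (S (n + 3))) + stableRank (S j) ((S i).tprod (S (n + 1))) := by
  rw [stableRank_congr (Representation.TensorProduct.assoc (S 2) (S i) (S (n + 2))),
    stableRank_congr (equivLeftComm (S 2) (S i) (S (n + 2)))]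
  exact ((hS.tprod_two n hn).lTensor (S i)).stableRank_eq (S j)

lemma stableRank_tprod_two_one_right {i j : ℕ} :
    stableRank (S j) (((S 2).tprod (S i)).tprod (S 1)) = stableRank (S j) ((S i).tprod (S 2)) := by
  obtain ⟨e⟩ := hS.tprod_one 2
  rw [stableRank_congr (Representation.TensorProduct.assoc (S 2) (S i) (S 1)),
    stableRank_congr (equivLeftComm (S 2) (S i) (S 1))]
  exact stableRank_congr (equivLTensor e (S i)) _

/-- Strong induction on n: expanding V_2 ⊗ V_i ⊗ V_{n+1} through either factor expresses index n + 2
by indices n + 1 and n. The range of i includes p, since i + 1 may reach it; there both sides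
vanish, which is the source of the truncation i + n + j < 2p. -/
theorem stableRank_tprod [∀ n, Module.Finite k (W n)] {j : ℕ} (hj : 1 ≤ j) (hj' : j < p)
    (n : ℕ) (hn : n + 1 < p) :
    ∀ i, 1 ≤ i → i ≤ p → stableRank (S j) ((S i).tprod (S (n + 1))) = fusion p i (n + 1) j := by
  induction n using Nat.strong_induction_on with | _ n ih
  have hleft (i n : ℕ) (hi : 1 ≤ i) (hi' : i < p)
      (h : ∀ i, 1 ≤ i → i ≤ p →
        stableRank (S j) ((S i).tprod (S (n + 1))) = fusion p i (n + 1) j) :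
      stableRank (S j) (((S 2).tprod (S i)).tprod (S (n + 1))) =
        fusion p (i + 1) (n + 1) j + fusion p (i - 1) (n + 1) j := by
    obtain rfl | ⟨i, rfl⟩ : i = 1 ∨ ∃ d, i = d + 2 := by
      rcases i with _ | _ | i
      · omega
      · exact .inl rfl
      · exact .inr ⟨i, rfl⟩
    · rw [hS.stableRank_tprod_two_one_left, h 2 (by omega) (by omega)]
      unfold fusion
      split_ifs <;> omega
    · rw [hS.stableRank_tprod_two_left hi', h (i + 3) (by omega) (by omega),
        h (i + 1) (by omega) (by omega)]
      rfl
  intro i hi hi'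
  obtain rfl | hip := eq_or_ne i p
  · rw [hS.stableRank_top_tprod]
    unfold fusion
    split_ifs <;> omega
  have hip' : i < p := by omega
  rcases n with _ | _ | n
  · obtain ⟨e⟩ := hS.tprod_one i
    rw [zero_add, stableRank_congr e]
    obtain rfl | hij := eq_or_ne j i
    · rw [hS.stableRank_self hj hj']
      unfold fusion
      split_ifs <;> omega
    · rw [hS.stableRank_of_ne hj hj' hi hip' hij]
      unfold fusion
      split_ifs <;> omega
  · have h1 := hleft i 0 hi hip' (ih 0 (by omega) (by omega))
    rw [zero_add, hS.stableRank_tprod_two_one_right] at h1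
    rw [zero_add, h1, ← fusion_add p i 0 j hi hip' hj hj' (by omega)]
    unfold fusion
    split_ifs <;> omega
  · have h1 := hleft i (n + 1) hi hip' (ih (n + 1) (by omega) (by omega))
    rw [hS.stableRank_tprod_two_right (by omega), ih n (by omega) (by omega) i hi hi',
      ← fusion_add p i (n + 1) j hi hip' hj hj' (by omega)] at h1
    exact Nat.add_right_cancel h1

lemma id_mem_stableIdeal {n : ℕ} (hn : 1 ≤ n) (hn' : n ≤ p) :
    .id (S n) ∈ stableIdeal (fun i : State p => S i) (S n) (S n) := by
  obtain rfl | hnp := eq_or_ne n p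
  · obtain ⟨φ, hφ⟩ := hS.projective
    rw [← hφ]
    exact transfer_mem_stableIdeal φ
  · exact comp_mem_stableIdeal (S := fun i : State p => S i)
      (i := ⟨n, Finset.mem_Icc.2 ⟨hn, by omega⟩⟩) (.id (S n)) (.id (S n))

lemma id_tprod_two_mem_stableIdeal {n : ℕ} (hn : 1 ≤ n) (hn' : n < p) :
    .id ((S 2).tprod (S n)) ∈
      stableIdeal (fun i : State p => S i) ((S 2).tprod (S n)) ((S 2).tprod (S n)) := by
  have := hS.two_lt
  obtain rfl | ⟨d, rfl⟩ : n = 1 ∨ ∃ d, n = d + 2 := by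
    rcases n with _ | _ | n
    · omega
    · exact .inl rfl
    · exact .inr ⟨n, rfl⟩
  · obtain ⟨e⟩ := hS.tprod_one 2
    exact id_mem_stableIdeal_of_isSummand (isSummand_of_equiv e)
      (hS.id_mem_stableIdeal (by omega) (by omega))
  · exact (hS.tprod_two d hn').id_mem_stableIdeal (hS.id_mem_stableIdeal (by omega) (by omega))
      (hS.id_mem_stableIdeal (by omega) (by omega))

lemma isSummand_succ {n : ℕ} (hn : 1 ≤ n) (hn' : n < p) :
    IsSummand (S (n + 1)) ((S 2).tprod (S n)) := by
  obtain rfl | ⟨d, rfl⟩ : n = 1 ∨ ∃ d, n = d + 2 := by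
    rcases n with _ | _ | n
    · omega
    · exact .inl rfl
    · exact .inr ⟨n, rfl⟩
  · obtain ⟨e⟩ := hS.tprod_one 2
    exact isSummand_of_equiv e.symm
  · exact (hS.tprod_two d hn').isSummand_left

/-- V_{n+2} is a summand of V_2 ⊗ V_{n+1}, so V_i ⊗ V_{n+2} is a summand of V_2 ⊗ (V_i ⊗ V_{n+1}),
and tensoring with V_2 preserves the ideal. -/
theorem id_tprod_mem_stableIdeal {i : ℕ} (hi : 1 ≤ i) (hi' : i < p) (n : ℕ) (hn : n + 1 < p) :
    .id ((S i).tprod (S (n + 1))) ∈ stableIdeal (fun i : State p => S i)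
      ((S i).tprod (S (n + 1))) ((S i).tprod (S (n + 1))) := by
  induction n with
  | zero =>
    obtain ⟨e⟩ := hS.tprod_one i
    exact id_mem_stableIdeal_of_isSummand (isSummand_of_equiv e)
      (hS.id_mem_stableIdeal hi hi'.le)
  | succ n ih =>
    have h1 := lTensor_mem_stableIdeal (ρ := S 2) (S := fun i : State p => S i) (fun j =>
      hS.id_tprod_two_mem_stableIdeal (Finset.mem_Icc.1 j.2).1
        (by have := (Finset.mem_Icc.1 j.2).2; omega)) (ih (by omega))
    rw [IntertwiningMap.lTensor_id] at h1
    refine id_mem_stableIdeal_of_isSummand ?_ h1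
    exact ((hS.isSummand_succ (n := n + 1) (by omega) (by omega)).lTensor (S i)).trans
      (isSummand_of_equiv (equivLeftComm (S i) (S 2) (S (n + 1))))

lemma exists_eq_smul' (i : State p) (f : (S i).IntertwiningMap (S i)) :
    ∃ c : k, f = c • .id (S i) := by
  have := Finset.mem_Icc.1 i.2
  exact hS.exists_eq_smul i (by omega) (by omega) f

lemma eq_zero' (i j : State p) (f : (S i).IntertwiningMap (S j)) (h : i ≠ j) : f = 0 := by
  have := Finset.mem_Icc.1 i.2
  have := Finset.mem_Icc.1 j.2
  exact hS.eq_zero i j (by omega) (by omega) (by omega) (by omega) (fun h' => h (Subtype.ext h')) f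

theorem multiplicity_tprod [∀ n, Module.Finite k (W n)] (i j : State p) {n : ℕ} (hn : 1 ≤ n)
    (hn' : n < p) : multiplicity ((S i).tprod (S n)) (S j) = fusion p i n j := by
  obtain ⟨n, rfl⟩ := Nat.exists_eq_add_of_le' hn
  have hi := Finset.mem_Icc.1 i.2
  have hj := Finset.mem_Icc.1 j.2
  have h := hS.stableRank_tprod (j := j) hj.1 (by omega) n hn' i hi.1 (by omega)
  rw [← h]
  refine multiplicity_eq_stableRank (S := fun i : State p => S i) hS.exists_eq_smul' hS.eq_zero'
    (hS.id_tprod_mem_stableIdeal hi.1 (by omega) n hn') ?_ ?_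
  · rw [hS.stableRank_self hj.1 (by omega)]
    exact one_ne_zero
  · rw [h]
    unfold fusion
    split_ifs <;> omega

theorem exists_equiv_of_multiplicity_ne_zero {X : Type*}
    [AddCommGroup X] [Module k X] [Module.Finite k X] {ρ : Representation k G X}
    (h : IsIndecomposable ρ) (hp : ¬ IsProjective ρ) (i : State p) {n : ℕ} (hn : 1 ≤ n)
    (hn' : n < p) (hm : multiplicity ((S i).tprod (S n)) ρ ≠ 0) :
    ∃ j : State p, Nonempty (ρ.Equiv (S j)) := by
  obtain ⟨n, rfl⟩ := Nat.exists_eq_add_of_le' hn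
  have hi := Finset.mem_Icc.1 i.2
  exact h.exists_equiv hp hS.exists_eq_smul' (id_mem_stableIdeal_of_isSummand
    (isSummand_of_multiplicity_ne_zero hm) (hS.id_tprod_mem_stableIdeal hi.1 (by omega) n hn'))

end IsFusionFamily

end Family

/-! ### The modules of SL₂(𝔽_p) and the transition matrix -/

section Instance

variable (k : Type u) [Field k] (p : ℕ) [CharP k p]

/-- Constants as forms of degree zero. -/
noncomputable def formsZeroEquiv : Forms k 0 ≃ₗ[k] k :=
  LinearEquiv.ofLinearMap (MvPolynomial.lcoeff k 0 ∘ₗ (Forms k 0).subtype)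
    (LinearMap.toSpanSingleton k (Forms k 0) ⟨1, MvPolynomial.isHomogeneous_one _ _⟩)
    (by ext; simp)
    (by
      refine LinearMap.ext fun f => Subtype.ext ?_
      obtain ⟨c, hc⟩ := exists_algebraMap_eq f
      simp [← hc, MvPolynomial.algebraMap_eq, MvPolynomial.smul_eq_C_mul])

/-- `V_1` is the trivial module. -/
noncomputable def homogRepOneEquiv :
    (homogRep k p 1).Equiv (Representation.trivial k (SL2 p) k) :=
  .mk (formsZeroEquiv k) fun g => by
    refine LinearMap.ext fun f => ?_
    have hf : homogRep k p 1 g f = f := by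
      refine Subtype.ext ?_
      obtain ⟨c, hc⟩ := exists_algebraMap_eq (k := k) f
      refine (coe_homogRep k p 1 g f).trans ?_
      rw [← hc]
      exact (substHom k p g).commutes c
    exact congrArg (formsZeroEquiv k) hf

theorem isFusionFamily_homogRep [Fact p.Prime] (hp : 2 < p) :
    IsFusionFamily p (homogRep k p) where
  two_lt := hp
  exists_eq_smul n hn hn' F := exists_eq_smul_id hn hn'.le F
  eq_zero m n hm hm' hn hn' h F := intertwiningMap_eq_zero hm hm'.le hn hn'.le h F
  not_projective n hn hn' := not_isProjective_homogRep hn hn'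
  projective := exists_transfer_eq_id
  tprod_one n := ⟨(equivLTensor (homogRepOneEquiv k p) (homogRep k p n)).trans
    (Representation.TensorProduct.rid k (homogRep k p n))⟩
  tprod_two d hd := isBiproduct_tprod_two k d (by
    rw [Ne, CharP.cast_eq_zero_iff k p]
    intro h
    have := Nat.le_of_dvd (by omega) h
    omega)

variable {k p}

lemma A_eq_fusion [Fact p.Prime] {n : ℕ} (hn : 2 ≤ n) (hnp : n + 2 ≤ p) (i j : State p) :
    A k p n i j = fusion p i n j :=
  (isFusionFamily_homogRep k p (by omega)).multiplicity_tprod i j (by omega) (by omega)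

lemma isIndecomposable_V [Fact p.Prime] (i : State p) :
    IsIndecomposable (V k p i).ρ ∧ ¬ IsProjective (V k p i).ρ := by
  have := Finset.mem_Icc.1 i.2
  exact ⟨isIndecomposable_homogRep this.1 (by omega),
    not_isProjective_homogRep this.1 (by omega)⟩

/-- The sum over all isomorphism classes collapses to the states: any class that contributes is some
V_j, and different V_j are told apart by dimension. -/
lemma finsum_multiplicity [Fact p.Prime] {n : ℕ} (hn : 2 ≤ n) (hnp : n + 2 ≤ p)
    (hV : ∀ i : State p, IsIndecomposable (V k p i).ρ ∧ ¬ IsProjective (V k p i).ρ) (i : State p) :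
    ∑ᶠ M : IsoClass k (SL2 p), (1 : ℝ) *
      (multiplicity (Representation.tprod (V k p i).ρ (homogRep k p n)) M.out.1.ρ : ℝ) =
      degree k p n i := by
  classical
  have hS := isFusionFamily_homogRep k p (show 2 < p by omega)
  let cls : State p → IsoClass k (SL2 p) := fun j => Quotient.mk _ ⟨V k p j, hV j⟩
  have hout (j : State p) :
      Nonempty (Representation.Equiv (cls j).out.1.ρ (homogRep k p j)) :=
    Quotient.mk_out (s := isoSetoid k (SL2 p)) ⟨V k p j, hV j⟩
  have hinj : Function.Injective cls := by
    intro a b hab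
    obtain ⟨e⟩ : Nonempty ((homogRep k p a).Equiv (homogRep k p b)) := Quotient.exact hab
    have ha := Finset.mem_Icc.1 a.2
    have hb := Finset.mem_Icc.1 b.2
    have h : Module.finrank k (Forms k (a - 1)) = Module.finrank k (Forms k (b - 1)) :=
      e.toLinearEquiv.finrank_eq
    rw [finrank_forms, finrank_forms] at h
    exact Subtype.ext (by omega)
  have hmult (j : State p) :
      multiplicity ((homogRep k p i).tprod (homogRep k p n)) (cls j).out.1.ρ = A k p n i j := by
    obtain ⟨e⟩ := hout j
    exact multiplicity_congr (X := Forms k (i - 1) ⊗[k] Forms k (n - 1)) e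
  rw [finsum_eq_sum_of_support_subset (s := Finset.univ.image cls), Finset.sum_image hinj.injOn,
    degree, Nat.cast_sum]
  · refine Finset.sum_congr rfl fun j _ => ?_
    rw [one_mul]
    exact congrArg Nat.cast (hmult j)
  · intro M hM
    have hM' : multiplicity ((homogRep k p i).tprod (homogRep k p n)) M.out.1.ρ ≠ 0 := by
      intro h
      apply hM
      change (1 : ℝ) * (multiplicity ((homogRep k p i).tprod (homogRep k p n)) M.out.1.ρ : ℝ) = 0
      rw [h, Nat.cast_zero, mul_zero]
    obtain ⟨j, ⟨e⟩⟩ := hS.exists_equiv_of_multiplicity_ne_zero M.out.2.1 M.out.2.2 i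
      (by omega) (by omega) hM'
    rw [Finset.coe_image, Finset.coe_univ, Set.image_univ]
    refine ⟨j, ?_⟩
    rw [← Quotient.out_eq M]
    exact (Quotient.sound (s := isoSetoid k (SL2 p)) ⟨e⟩).symm

lemma Q_apply [Fact p.Prime] {n : ℕ} (hn : 2 ≤ n) (hnp : n + 2 ≤ p)
    (hV : ∀ i : State p, IsIndecomposable (V k p i).ρ ∧ ¬ IsProjective (V k p i).ρ)
    (i j : State p) :
    Q k p n (fun _ => 1) hV i j = (A k p n i j : ℝ) / degree k p n i := by
  rw [← finsum_multiplicity hn hnp hV i, Q, transitionProb, one_mul]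
  rfl

end Instance

/-! ### Degrees and their sum -/

section Arithmetic

lemma fusion_comm (p i n j : ℕ) : fusion p i n j = fusion p j n i := by
  unfold fusion
  split_ifs <;> omega

lemma sum_fusion (p i n : ℕ) (hi : 1 ≤ i) (hi' : i < p) (hn : 1 ≤ n) (hn' : n < p) :
    ∑ j ∈ Finset.Icc 1 (p - 1), fusion p i n j = min (min i (p - i)) (min n (p - n)) := by
  -- The neighbours of i form an arithmetic progression of step 2 starting at |i - n| + 1.
  have h : (Finset.Icc 1 (p - 1)).filter (fun j => (i + n + j) % 2 = 1 ∧ i < n + j ∧ n < i + j ∧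
      j < i + n ∧ i + n + j < 2 * p) =
      (Finset.range (min (min i (p - i)) (min n (p - n)))).image
        fun t => max i n - min i n + 1 + 2 * t := by
    ext j
    simp only [Finset.mem_filter, Finset.mem_Icc, Finset.mem_image, Finset.mem_range]
    constructor
    · rintro ⟨h1, h2⟩
      exact ⟨(j - 1 - (max i n - min i n)) / 2, by omega, by omega⟩
    · rintro ⟨t, ht, rfl⟩
      omega
  unfold fusion
  rw [← Finset.sum_filter, h, Finset.sum_const, smul_eq_mul, mul_one,
    Finset.card_image_of_injective _ fun a b hab => by simpa using hab, Finset.card_range]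

lemma sum_range_sub_two_mul (p m : ℕ) (hm : 2 * m ≤ p) :
    ∑ t ∈ Finset.range m, (p - 2 * t - 1) = m * (p - m) := by
  induction m with
  | zero => simp
  | succ m ih =>
    rw [Finset.sum_range_succ, ih (by omega)]
    obtain ⟨q, rfl⟩ := Nat.exists_eq_add_of_le hm
    have h1 : 2 * (m + 1) + q - m = m + 2 + q := by omega
    have h2 : 2 * (m + 1) + q - 2 * m - 1 = q + 1 := by omega
    have h3 : 2 * (m + 1) + q - (m + 1) = m + 1 + q := by omega
    rw [h1, h2, h3]
    ring

/-- Layer-cake count: the minimum is the number of t < m with t < i < p - t. Exchanging the sums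
leaves p - 2t - 1 values of i for each t. -/
lemma sum_min (p m : ℕ) (hm : 2 * m ≤ p) :
    ∑ i ∈ Finset.Icc 1 (p - 1), min (min i (p - i)) m = m * (p - m) := by
  rw [← sum_range_sub_two_mul p m hm]
  have h (i : ℕ) : min (min i (p - i)) m =
      ∑ t ∈ Finset.range m, if t < i ∧ t < p - i then 1 else 0 := by
    rw [← Finset.sum_filter, Finset.sum_const, smul_eq_mul, mul_one]
    have : (Finset.range m).filter (fun t => t < i ∧ t < p - i) =
        Finset.range (min (min i (p - i)) m) := by
      ext t
      simp only [Finset.mem_filter, Finset.mem_range]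
      omega
    rw [this, Finset.card_range]
  simp only [h]
  rw [Finset.sum_comm]
  refine Finset.sum_congr rfl fun t ht => ?_
  rw [← Finset.sum_filter, Finset.sum_const, smul_eq_mul, mul_one]
  have : (Finset.Icc 1 (p - 1)).filter (fun i => t < i ∧ t < p - i) =
      Finset.Ioo t (p - t) := by
    ext i
    simp only [Finset.mem_filter, Finset.mem_Icc, Finset.mem_Ioo]
    omega
  rw [this, Nat.card_Ioo]
  omega

lemma sum_min_min (p n : ℕ) (hn : n ≤ p) :
    ∑ i ∈ Finset.Icc 1 (p - 1), min (min i (p - i)) (min n (p - n)) = n * (p - n) := by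
  rw [sum_min p _ (by omega)]
  obtain h | h := le_total n (p - n)
  · rw [min_eq_left h]
  · rw [min_eq_right h, Nat.sub_sub_self hn, mul_comm]

/-- The involution `i ↦ p - i` of the states. -/
def stateNeg (p : ℕ) : Equiv.Perm (State p) where
  toFun i := ⟨p - i, by have := Finset.mem_Icc.1 i.2; rw [Finset.mem_Icc]; omega⟩
  invFun i := ⟨p - i, by have := Finset.mem_Icc.1 i.2; rw [Finset.mem_Icc]; omega⟩
  left_inv i := by have := Finset.mem_Icc.1 i.2; refine Subtype.ext ?_; dsimp only; omega
  right_inv i := by have := Finset.mem_Icc.1 i.2; refine Subtype.ext ?_; dsimp only; omega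

end Arithmetic

end SummandWalk

theorem mainTheorem10 (k : Type u) [Field k] [IsAlgClosed k] (p : ℕ) [Fact p.Prime] [CharP k p]
    (n : ℕ) (hn : 2 ≤ n) (hnp : n + 2 ≤ p) :
    ∃ hV : ∀ i : SummandWalk.State p, SummandWalk.IsIndecomposable (SummandWalk.V k p i).ρ ∧
        ¬ SummandWalk.IsProjective (SummandWalk.V k p i).ρ,
      let Q := SummandWalk.Q k p n (fun _ => 1) hV
      let π : SummandWalk.State p → ℝ := fun i =>
        min (min ((i : ℕ) : ℝ) ((p : ℝ) - (i : ℕ))) (min (n : ℝ) ((p : ℝ) - n)) /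
          ((n : ℝ) * ((p : ℝ) - n))
      Q ∈ Matrix.rowStochastic ℝ (SummandWalk.State p) ∧
      (∀ i j, Q i j = (SummandWalk.A k p n i j : ℝ) / (SummandWalk.degree k p n i : ℝ)) ∧
      SummandWalk.IsStationaryDistribution Q π ∧
      (∑ i : SummandWalk.State p with Odd i.val, π i) = 1 / 2 ∧
      (∑ i : SummandWalk.State p with Even i.val, π i) = 1 / 2 := by
  refine ⟨SummandWalk.isIndecomposable_V, ?_⟩
  intro Q π
  have hQ (i j) : Q i j = (SummandWalk.A k p n i j : ℝ) / (SummandWalk.degree k p n i : ℝ) :=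
    SummandWalk.Q_apply hn hnp _ i j
  have hmem (i : SummandWalk.State p) := Finset.mem_Icc.1 i.2
  have hdeg (i : SummandWalk.State p) :
      SummandWalk.degree k p n i = min (min (i : ℕ) (p - i)) (min n (p - n)) := by
    rw [← SummandWalk.sum_fusion p i n (hmem i).1 (by have := hmem i; omega) (by omega) (by omega),
      ← Finset.sum_coe_sort]
    exact Finset.sum_congr rfl fun j _ => SummandWalk.A_eq_fusion hn hnp i j
  have hdeg0 (i : SummandWalk.State p) : (SummandWalk.degree k p n i : ℝ) ≠ 0 := by
    rw [hdeg, Nat.cast_ne_zero]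
    have := hmem i
    omega
  have hN : ((n * (p - n) : ℕ) : ℝ) = (n : ℝ) * ((p : ℝ) - n) := by
    rw [Nat.cast_mul, Nat.cast_sub (by omega)]
  have hN0 : ((n * (p - n) : ℕ) : ℝ) ≠ 0 := by
    rw [Nat.cast_ne_zero]
    exact Nat.mul_ne_zero (by omega) (by omega)
  have hπ (i : SummandWalk.State p) :
      π i = (SummandWalk.degree k p n i : ℝ) / ((n * (p - n) : ℕ) : ℝ) := by
    have := hmem i
    rw [hN, hdeg, Nat.cast_min, Nat.cast_min, Nat.cast_min, Nat.cast_sub (by omega),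
      Nat.cast_sub (by omega)]
  have hsum : ∑ i, π i = 1 := by
    simp only [hπ]
    rw [← Finset.sum_div, div_eq_one_iff_eq hN0, ← Nat.cast_sum, Nat.cast_inj,
      ← SummandWalk.sum_min_min p n (by omega), ← Finset.sum_coe_sort (Finset.Icc 1 (p - 1))]
    exact Finset.sum_congr rfl fun i _ => hdeg i
  have hpar : (∑ i : SummandWalk.State p with Odd i.val, π i) =
      ∑ i : SummandWalk.State p with Even i.val, π i := by
    -- The bounds on n force p ≥ 4.
    have hodd : Odd p := (Fact.out : p.Prime).odd_of_ne_two (by omega)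
    rw [Finset.sum_filter, Finset.sum_filter,
      ← Equiv.sum_comp (SummandWalk.stateNeg p)]
    refine Finset.sum_congr rfl fun i _ => ?_
    have hi := hmem i
    have h1 : π (SummandWalk.stateNeg p i) = π i := by
      rw [hπ, hπ, hdeg, hdeg]
      have : ((SummandWalk.stateNeg p i : SummandWalk.State p) : ℕ) = p - i := rfl
      rw [this, Nat.sub_sub_self (by omega), min_comm (p - (i : ℕ))]
    rw [h1]
    refine if_congr ?_ rfl rfl
    change Odd (p - (i : ℕ)) ↔ _
    rw [Nat.odd_sub (by omega)]
    tauto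
  have htot : (∑ i : SummandWalk.State p with Odd i.val, π i) +
      (∑ i : SummandWalk.State p with Even i.val, π i) = 1 := by
    rw [← hsum, ← Finset.sum_filter_add_sum_filter_not Finset.univ
      (fun i : SummandWalk.State p => Odd i.val)]
    simp only [Nat.not_odd_iff_even]
  refine ⟨?_, hQ, ⟨⟨fun i => ?_, hsum⟩, ?_⟩, by linarith, by linarith⟩
  · rw [Matrix.mem_rowStochastic_iff_sum]
    refine ⟨fun i j => ?_, fun i => ?_⟩
    · rw [hQ]
      positivity
    · simp only [hQ]
      rw [← Finset.sum_div, div_eq_one_iff_eq (hdeg0 i), SummandWalk.degree, Nat.cast_sum]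
  · rw [hπ]
    positivity
  · ext j
    rw [Matrix.vecMul, dotProduct]
    -- Detailed balance: the degree cancels, and symmetry of `fusion` in i and j leaves an entry of
    -- row j of A.
    have h (i : SummandWalk.State p) :
        π i * Q i j = (SummandWalk.A k p n j i : ℝ) / ((n * (p - n) : ℕ) : ℝ) := by
      rw [hπ, hQ, SummandWalk.A_eq_fusion hn hnp j i, SummandWalk.fusion_comm,
        ← SummandWalk.A_eq_fusion (k := k) hn hnp i j]
      field_simp [hdeg0 i]
    simp only [h]
    rw [← Finset.sum_div, hπ, SummandWalk.degree, Nat.cast_sum]
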